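/- Let $\mathbb N$ be a real antisymmetric $n\times n$ matrix of corank $d$ (that is, of rank $n-d$). Then $n=2k+d$ for some $k\ge 0$ and there are an orthogonal $n\times n$ matrix $O$ and an invertible antisymmetric $2k\times 2k$ matrix $\bar{\mathbb N}$ with $$\mathbb N=O\begin{pmatrix}\bar{\mathbb N}&0\\0&0\end{pmatrix}O^T .$$ For every such $O$ and $\bar{\mathbb N}$ put $\Omega=-\bar{\mathbb N}^{-1}$ and $M^{\rm sym}=\frac12(M+M^T)$, and consider the following objects. * $\operatorname{Sp}(\mathbb R^{2k},\Omega)=\{g : g^T\Omega g=\Omega\}$. * $\operatorname{H}(\mathbb R^{2k},\Omega;\mathbb R^d)$, the group of pairs $(\mathcal A,\mathcal B)$ of a real $2k\times d$ matrix $\mathcal A$ and a symmetric $d\times d$ matrix $\mathcal B$, with $(\mathcal A,\mathcal B)(\mathcal A',\mathcal B')=\bigl(\mathcal A+\mathcal A',\ \mathcal B+\mathcal B'+\tfrac12(\mathcal A^T\Omega\mathcal A')^{\rm sym}\bigr)$. * The generalized Jacobi group $\operatorname{Jac}(2k,d,\Omega)=\operatorname{Sp}(\mathbb R^{2k},\Omega)\ltimes\operatorname{H}(\mathbb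 R^{2k},\Omega;\mathbb R^d)$ for the action $g\cdot(\mathcal A,\mathcal B)=(g\mathcal A,\mathcal B)$. It is a Lie group, a closed submanifold of the space of triples $(g,\mathcal A,\mathcal B)$ of matrices. Its tangent space $\mathfrak{jac}$ at the identity consists of the triples $(\mathcal S,\mathcal A,\mathcal B)$ with $\Omega\mathcal S+\mathcal S^T\Omega=0$ and $\mathcal B^T=\mathcal B$. * The function $\ell(\mathcal S,\mathcal A,\mathcal B)=\tfrac12\operatorname{Tr}\bigl(\mathcal S^T(-\bar{\mathbb N}^{-2})\mathcal S\bigr)+\operatorname{Tr}\bigl(\mathcal A^T(-\bar{\mathbb N}^{-2})\mathcal A\bigr)+2\operatorname{Tr}(\mathcal B^2)$. * The linear map $\Theta(\mathcal S,\mathcal A,\mathcal B)=O\begin{pmatrix}\bar{\mathbb N}^{-1}\mathcal S&\bar{\mathbb N}^{-1}\mathcal A\\(\bar{\mathbb N}^{-1}\mathcal A)^T&2\mathcal B\end{pmatrix}O^T$. Then: 1. $\ell$ is positive definite on $\mathfrak{jac}$, so it defines a left-invariant Riemannian metric on $\operatorname{Jac}(2k,d,\Omega)$, with kinetic energy $\ell(\gamma^{-1}\dot\gamma)$;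 and $\Theta$ is a bijection from $\mathfrak{jac}$ onto the space of symmetric $n\times n$ matrices. 2. A $C^2$ curve $\gamma:I\to\operatorname{Jac}(2k,d,\Omega)$ on an open interval $I$ is a geodesic of this metric (a critical point of $\int_a^b\ell(\gamma^{-1}\dot\gamma)\,dt$ under $C^2$ variations with fixed end points, for all $a<b$ in $I$) if and only if $X(t)=\Theta(\gamma(t)^{-1}\dot\gamma(t))$ is a symmetric-matrix-valued solution on $I$ of the Bloch–Iserles system $\dot X(t)=[X(t)^2,\mathbb N]$. 3. Every symmetric-matrix-valued solution $X$ of the Bloch–Iserles system on an open interval $I$ arises in this way; for given $t_0\in I$ and $g_0\in\operatorname{Jac}(2k,d,\Omega)$ the geodesic can be chosen with $\gamma(t_0)=g_0$. -/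

import Mathlib

open scoped Matrix

set_option linter.unusedSectionVars false

-- Spaces of matrices are normed by the sup norm of the entries; only the resulting (norm
-- independent) notions of derivative and of `C²` map are used below.
attribute [local instance] Matrix.normedAddCommGroup Matrix.normedSpace

noncomputable section

namespace BlochIserles

/-! ### The Bloch–Iserles system -/

/-- `X` is, on `I`, a solution in the space of symmetric matrices of `X' = [X², N]`. -/
def IsBlochIserlesSolutionOn {ι : Type*} [Fintype ι] [DecidableEq ι]
    (N : Matrix ι ι ℝ) (X : ℝ → Matrix ι ι ℝ) (I : Set ℝ) : Prop :=
  ∀ t ∈ I, (X t).IsSymm ∧ HasDerivAt X (X t ^ 2 * N - N * X t ^ 2) t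

/-! ### The generalized Jacobi group `Sp(V, Ω) ⋉ H(V, Ω; W)` -/

section Group

variable {m p : Type*} [Fintype m] [DecidableEq m]

/-- The symplectic group `Sp(ℝ^m, Ω)` of a bilinear form with matrix `Ω`. -/
def Sp (Ω : Matrix m m ℝ) : Subgroup (GL m ℝ) where
  carrier := {g | (g : Matrix m m ℝ)ᵀ * Ω * (g : Matrix m m ℝ) = Ω}
  one_mem' := by simp
  mul_mem' := by
    intro a b ha hb
    simp only [Set.mem_ofPred_eq] at ha hb ⊢
    calc ((a * b : GL m ℝ) : Matrix m m ℝ)ᵀ * Ω * ((a * b : GL m ℝ) : Matrix m m ℝ)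
        = (b : Matrix m m ℝ)ᵀ * ((a : Matrix m m ℝ)ᵀ * Ω * (a : Matrix m m ℝ))
            * (b : Matrix m m ℝ) := by
          simp [Matrix.transpose_mul, Matrix.mul_assoc]
      _ = Ω := by rw [ha, hb]
  inv_mem' := by
    intro a ha
    simp only [Set.mem_ofPred_eq] at ha ⊢
    have h1 : (a : Matrix m m ℝ) * ((a⁻¹ : GL m ℝ) : Matrix m m ℝ) = 1 := by
      rw [← Units.val_mul, mul_inv_cancel, Units.val_one]
    have h2 : ((a⁻¹ : GL m ℝ) : Matrix m m ℝ)ᵀ * (a : Matrix m m ℝ)ᵀ = 1 := by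
      rw [← Matrix.transpose_mul, h1, Matrix.transpose_one]
    calc ((a⁻¹ : GL m ℝ) : Matrix m m ℝ)ᵀ * Ω * ((a⁻¹ : GL m ℝ) : Matrix m m ℝ)
        = ((a⁻¹ : GL m ℝ) : Matrix m m ℝ)ᵀ * ((a : Matrix m m ℝ)ᵀ * Ω * (a : Matrix m m ℝ))
            * ((a⁻¹ : GL m ℝ) : Matrix m m ℝ) := by rw [ha]
      _ = (((a⁻¹ : GL m ℝ) : Matrix m m ℝ)ᵀ * (a : Matrix m m ℝ)ᵀ) * Ω
            * ((a : Matrix m m ℝ) * ((a⁻¹ : GL m ℝ) : Matrix m m ℝ)) := by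
          simp only [Matrix.mul_assoc]
      _ = Ω := by rw [h1, h2]; simp

/-- The symmetric part of a square matrix. -/
def symPart (M : Matrix p p ℝ) : Matrix p p ℝ := (1 / 2 : ℝ) • (M + Mᵀ)

/-- The group two-cocycle `½ (Aᵀ Ω A')^sym` of `L(ℝ^p, ℝ^m)` with values in `Sym(ℝ^p)`. -/
def cocycle (Ω : Matrix m m ℝ) (A A' : Matrix m p ℝ) : Matrix p p ℝ :=
  (1 / 2 : ℝ) • symPart (Aᵀ * Ω * A')

theorem cocycle_isSymm (Ω : Matrix m m ℝ) (A A' : Matrix m p ℝ) :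
    (cocycle Ω A A').IsSymm := by
  simp [cocycle, symPart, Matrix.IsSymm, add_comm]

theorem cocycle_add_left (Ω : Matrix m m ℝ) (A A' C : Matrix m p ℝ) :
    cocycle Ω (A + A') C = cocycle Ω A C + cocycle Ω A' C := by
  simp only [cocycle, symPart, Matrix.transpose_add, Matrix.add_mul]
  module

theorem cocycle_add_right (Ω : Matrix m m ℝ) (A C C' : Matrix m p ℝ) :
    cocycle Ω A (C + C') = cocycle Ω A C + cocycle Ω A C' := by
  simp only [cocycle, symPart, Matrix.transpose_add, Matrix.mul_add]
  module

theorem cocycle_neg_left (Ω : Matrix m m ℝ) (A C : Matrix m p ℝ) :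
    cocycle Ω (-A) C = -cocycle Ω A C := by
  simp only [cocycle, symPart, Matrix.transpose_neg, Matrix.neg_mul]
  module

theorem cocycle_zero_left (Ω : Matrix m m ℝ) (C : Matrix m p ℝ) : cocycle Ω 0 C = 0 := by
  simp [cocycle, symPart]

theorem cocycle_zero_right (Ω : Matrix m m ℝ) (C : Matrix m p ℝ) : cocycle Ω C 0 = 0 := by
  simp [cocycle, symPart]

theorem cocycle_sp (Ω : Matrix m m ℝ) (g : Sp Ω) (A C : Matrix m p ℝ) :
    cocycle Ω ((g : GL m ℝ).val * A) ((g : GL m ℝ).val * C) = cocycle Ω A C := by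
  have hg : (g : GL m ℝ).valᵀ * Ω * (g : GL m ℝ).val = Ω := g.2
  have h : ((g : GL m ℝ).val * A)ᵀ * Ω * ((g : GL m ℝ).val * C)
      = Aᵀ * ((g : GL m ℝ).valᵀ * Ω * (g : GL m ℝ).val) * C := by
    simp only [Matrix.transpose_mul, Matrix.mul_assoc]
  rw [cocycle, h, hg, cocycle]

/-- The generalized Heisenberg group `H(ℝ^m, Ω; ℝ^p)`: pairs of `A ∈ L(ℝ^p, ℝ^m)` and
`B ∈ Sym(ℝ^p)`, with `(A, B) (A', B') = (A + A', B + B' + ½ (Aᵀ Ω A')^sym)`. -/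
@[ext] structure Heis (p : Type*) (Ω : Matrix m m ℝ) where
  A : Matrix m p ℝ
  B : Matrix p p ℝ
  symm : B.IsSymm

namespace Heis

variable {Ω : Matrix m m ℝ}

instance : Mul (Heis p Ω) :=
  ⟨fun x y => ⟨x.A + y.A, x.B + y.B + cocycle Ω x.A y.A,
    (x.symm.add y.symm).add (cocycle_isSymm _ _ _)⟩⟩

instance : One (Heis p Ω) := ⟨⟨0, 0, Matrix.isSymm_zero⟩⟩

/-- For antisymmetric `Ω` the inverse is just `(-A, -B)`, the cocycle term being zero. -/
instance : Inv (Heis p Ω) :=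
  ⟨fun x => ⟨-x.A, -x.B + cocycle Ω x.A x.A, x.symm.neg.add (cocycle_isSymm _ _ _)⟩⟩

@[simp] theorem mul_A (x y : Heis p Ω) : (x * y).A = x.A + y.A := rfl
@[simp] theorem mul_B (x y : Heis p Ω) : (x * y).B = x.B + y.B + cocycle Ω x.A y.A := rfl
@[simp] theorem one_A : (1 : Heis p Ω).A = 0 := rfl
@[simp] theorem one_B : (1 : Heis p Ω).B = 0 := rfl
@[simp] theorem inv_A (x : Heis p Ω) : (x⁻¹).A = -x.A := rfl
@[simp] theorem inv_B (x : Heis p Ω) : (x⁻¹).B = -x.B + cocycle Ω x.A x.A := rfl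

instance : Group (Heis p Ω) :=
  Group.ofLeftAxioms
    (fun x y z => by
      ext1
      · simp [add_assoc]
      · simp only [mul_B, mul_A, cocycle_add_left, cocycle_add_right]; abel)
    (fun x => by ext1 <;> simp [cocycle_zero_left])
    (fun x => by
      ext1
      · simp
      · simp [cocycle_neg_left])

end Heis

/-- The action of `Sp(ℝ^m, Ω)` on the generalized Heisenberg group, `g (A, B) = (g A, B)`. -/
def spAction (p : Type*) (Ω : Matrix m m ℝ) : Sp Ω →* MulAut (Heis p Ω) where
  toFun g :=
    { toFun := fun x => ⟨(g : GL m ℝ).val * x.A, x.B, x.symm⟩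
      invFun := fun x => ⟨((g⁻¹ : Sp Ω) : GL m ℝ).val * x.A, x.B, x.symm⟩
      left_inv := fun x => by
        ext1
        · simp [← Matrix.mul_assoc]
        · rfl
      right_inv := fun x => by
        ext1
        · simp [← Matrix.mul_assoc]
        · rfl
      map_mul' := fun x y => by
        ext1
        · simp [Matrix.mul_add]
        · simp only [Heis.mul_B, cocycle_sp] }
  map_one' := by
    ext x : 1
    ext1 <;> simp
  map_mul' g h := by
    ext x : 1
    ext1
    · simp [Matrix.mul_assoc]
    · simp

/-- The generalized Jacobi group `Jac(ℝ^m, Ω; ℝ^p) = Sp(ℝ^m, Ω) ⋉ H(ℝ^m, Ω; ℝ^p)`. -/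
abbrev Jac (p : Type*) (Ω : Matrix m m ℝ) : Type _ := Heis p Ω ⋊[spAction p Ω] Sp Ω

/-- The vector space of all triples of matrices of the formats of `(g, A, B)`. -/
abbrev Ambient (m p : Type*) : Type _ := Matrix m m ℝ × Matrix m p ℝ × Matrix p p ℝ

/-- The inclusion `(g, A, B) ↦ (g, A, B)` of the generalized Jacobi group, as a closed
submanifold, in a space of matrices. It gives the group its smooth structure. -/
def Jac.coords {Ω : Matrix m m ℝ} (x : Jac p Ω) : Ambient m p :=
  ((x.right : GL m ℝ).val, x.left.A, x.left.B)

/-- The tangent space at the identity of the generalized Jacobi group: triples `(S, A, B)` with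
`S ∈ sp(ℝ^m, Ω)` and with `B` symmetric. -/
def jac (p : Type*) (Ω : Matrix m m ℝ) : Submodule ℝ (Ambient m p) where
  carrier := {ξ | Ω * ξ.1 + ξ.1ᵀ * Ω = 0 ∧ ξ.2.2.IsSymm}
  zero_mem' := by simp [Matrix.isSymm_zero]
  add_mem' := by
    rintro a b ⟨ha, ha'⟩ ⟨hb, hb'⟩
    refine ⟨?_, ha'.add hb'⟩
    have h : Ω * (a + b).1 + (a + b).1ᵀ * Ω
        = (Ω * a.1 + a.1ᵀ * Ω) + (Ω * b.1 + b.1ᵀ * Ω) := by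
      simp only [Prod.fst_add, Matrix.transpose_add, Matrix.mul_add, Matrix.add_mul]; abel
    rw [h, ha, hb, add_zero]
  smul_mem' := by
    rintro c a ⟨ha, ha'⟩
    refine ⟨?_, ha'.smul c⟩
    have h : Ω * (c • a).1 + (c • a).1ᵀ * Ω = c • (Ω * a.1 + a.1ᵀ * Ω) := by
      simp [smul_add]
    rw [h, ha, smul_zero]

end Group

/-! ### Geodesics of left-invariant metrics -/

section Geodesics

variable {G E : Type*} [Group G] [NormedAddCommGroup E] [NormedSpace ℝ E]

/-- For a Lie group `G` embedded by `c` in a vector space: the velocity `γ'(t)` of a curve,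
transported to the identity by the left translation by `γ(t)⁻¹` (that is, `γ(t)⁻¹ γ'(t)`). -/
def leftVelocity (c : G → E) (γ : ℝ → G) (t : ℝ) : E :=
  deriv (fun s => c ((γ t)⁻¹ * γ s)) t

/-- Let `ℓ` be half the squared norm of an inner product on the tangent space at the identity of
a Lie group `G` embedded by `c` in a vector space. The `C²` curve `γ`, on the open interval `I`,
is a geodesic for the left-invariant metric that extends this inner product: on each
`[a, b] ⊆ I` it is a critical point, under all `C²` variations with fixed end points, of the
energy `∫ ℓ(γ⁻¹ γ') dt`. -/
def IsGeodesicOn (c : G → E) (ℓ : E → ℝ) (γ : ℝ → G) (I : Set ℝ) : Prop :=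
  ContDiffOn ℝ 2 (fun t => c (γ t)) I ∧
  ∀ a ∈ I, ∀ b ∈ I, a < b → ∀ (δ : ℝ) (F : ℝ → ℝ → G), 0 < δ →
    ContDiffOn ℝ 2 (fun q : ℝ × ℝ => c (F q.1 q.2)) (Set.Ioo (-δ) δ ×ˢ I) →
    (∀ t ∈ I, F 0 t = γ t) →
    (∀ ε ∈ Set.Ioo (-δ) δ, F ε a = γ a ∧ F ε b = γ b) →
    HasDerivAt (fun ε => ∫ t in a..b, ℓ (leftVelocity c (F ε) t)) 0 0

end Geodesics

/-! ### The metric and the identification of `jac` with symmetric matrices -/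

section Metric

variable {ι m p : Type*} [Fintype m] [DecidableEq m] [Fintype p]

/-- `ℓ(S, A, B) = ½ Tr(Sᵀ (-N̄⁻²) S) + Tr(Aᵀ (-N̄⁻²) A) + 2 Tr(B²)`. -/
def lagrangian (Nb : Matrix m m ℝ) (ξ : Ambient m p) : ℝ :=
  1 / 2 * (ξ.1ᵀ * (-(Nb⁻¹ * Nb⁻¹)) * ξ.1).trace
    + (ξ.2.1ᵀ * (-(Nb⁻¹ * Nb⁻¹)) * ξ.2.1).trace
    + 2 * (ξ.2.2 * ξ.2.2).trace

/-- The symmetric matrix `O [[S, Aᵀ], [A, 2 B]] Oᵀ` for which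
`(N̄ S, N̄ Aᵀ, B)` is the given triple `(𝒮, 𝒜, ℬ)`. -/
def toSym (O : Matrix ι (m ⊕ p) ℝ) (Nb : Matrix m m ℝ) (ξ : Ambient m p) : Matrix ι ι ℝ :=
  O * Matrix.fromBlocks (Nb⁻¹ * ξ.1) (Nb⁻¹ * ξ.2.1) (Nb⁻¹ * ξ.2.1)ᵀ ((2 : ℝ) • ξ.2.2) * Oᵀ

end Metric

end BlochIserles

end

namespace BlochIserles

open Set Filter Topology MeasureTheory

/-! ### Linear differential equations on an open interval -/

section LinearODE

variable {E : Type*} [NormedAddCommGroup E] [NormedSpace ℝ E]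

/-! This is Euler–Poincaré reduction. On `jac` the map Θ turns ℓ into ½ Tr(X²) (`lagrangian_eq`) and
the Lie bracket into XNY − YNX (`toSym_bracket`). For a variation of a curve with left velocity ξ,
let η be the left-translated variation field, which vanishes at the end points. Then ∂ξ/∂ε = ∂η/∂t +
[ξ, η]. With X = Θξ and Y = Θη, integration by parts and `trace_mul_bracket` give the first
variation ∫ Tr((X²N − NX² − X′) Y) dt (`hasDerivAt_action`). The first factor is symmetric, and Y
can be any fixed symmetric matrix times a scalar weight (`exists_variation`), so criticality on all
subintervals forces X′ = [X², N].

The group enters only through matrix coordinates. The symplectic relation gives g⁻¹ = N̄ gᵀ N̄⁻¹, so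
left translation to the identity has the form P v + B(u, v), with P linear and B bilinear. For such
an expression the first variation is a computation in a vector space (`hasDerivAt_energy`). It
produces B(u_ε, u_t) − B(u_t, u_ε), which `leftBilin_sub_leftBilin` identifies with the bracket.

To recover a geodesic from a solution X, set ξ = Θ⁻¹X and solve γ′ = γξ. The symplectic component
satisfies a linear equation, solvable on all of I by a Dyson series (`exists_hasDerivAt_linear`);
the Heisenberg components are then integrals (`exists_curve_jac`). The normal form of N comes from
diagonalising NᵀN. -/

theorem exists_Icc_subset {I : Set ℝ} (hI : IsOpen I) (hc : I.OrdConnected) {s t : ℝ}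
    (hs : s ∈ I) (ht : t ∈ I) :
    ∃ c d, s ∈ Ioo c d ∧ t ∈ Ioo c d ∧ Icc c d ⊆ I := by
  have key : ∀ r ∈ I, ∃ e > 0, r - e ∈ I ∧ r + e ∈ I := by
    intro r hr
    obtain ⟨e, he, h⟩ := Metric.isOpen_iff.1 hI r hr
    refine ⟨e / 2, half_pos he, h ?_, h ?_⟩ <;>
      simp [abs_of_pos he, he]
  obtain ⟨e₁, he₁, h1, h1'⟩ := key s hs
  obtain ⟨e₂, he₂, h2, h2'⟩ := key t ht
  rcases le_total s t with h | h
  · refine ⟨s - e₁, t + e₂, ⟨?_, ?_⟩, ⟨?_, ?_⟩, hc.out h1 h2'⟩ <;> linarith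
  · refine ⟨t - e₂, s + e₁, ⟨?_, ?_⟩, ⟨?_, ?_⟩, hc.out h2 h1'⟩ <;> linarith

theorem hasDerivAt_primitive [CompleteSpace E] {I : Set ℝ} (hI : IsOpen I) (hc : I.OrdConnected)
    {f : ℝ → E} (hf : ContinuousOn f I) {t₀ t : ℝ} (ht₀ : t₀ ∈ I) (ht : t ∈ I) :
    HasDerivAt (fun s => ∫ r in t₀..s, f r) (f t) t :=
  intervalIntegral.integral_hasDerivAt_right
    (hf.mono (hc.uIcc_subset ht₀ ht)).intervalIntegrable
    (hf.stronglyMeasurableAtFilter hI t ht) (hf.continuousAt (hI.mem_nhds ht))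

/-- The terms of the Dyson series of the equation `x' = L x`, `x t₀ = x₀`. -/
noncomputable def dyson (L : ℝ → E →L[ℝ] E) (t₀ : ℝ) (x₀ : E) : ℕ → ℝ → E
  | 0, _ => x₀
  | n + 1, t => ∫ s in t₀..t, L s (dyson L t₀ x₀ n s)

variable [CompleteSpace E] {I : Set ℝ} {L : ℝ → E →L[ℝ] E} {t₀ : ℝ}

theorem dyson_continuousOn (hI : IsOpen I) (hc : I.OrdConnected) (hL : ContinuousOn L I)
    (ht₀ : t₀ ∈ I) (x₀ : E) : ∀ n, ContinuousOn (dyson L t₀ x₀ n) I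
  | 0 => continuousOn_const
  | n + 1 => fun _ ht => (hasDerivAt_primitive hI hc
      (hL.clm_apply (dyson_continuousOn hI hc hL ht₀ x₀ n)) ht₀ ht).continuousAt.continuousWithinAt

theorem dyson_hasDerivAt (hI : IsOpen I) (hc : I.OrdConnected) (hL : ContinuousOn L I)
    (ht₀ : t₀ ∈ I) (x₀ : E) (n : ℕ) {t : ℝ} (ht : t ∈ I) :
    HasDerivAt (dyson L t₀ x₀ (n + 1)) (L t (dyson L t₀ x₀ n t)) t :=
  hasDerivAt_primitive hI hc (hL.clm_apply (dyson_continuousOn hI hc hL ht₀ x₀ n)) ht₀ ht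

/-- Iterating the integral n times contributes Kⁿ from the coefficients and |t − t₀|ⁿ / n! from the
volume of a simplex. The absolute values treat both sides of `t₀` at once. -/
theorem norm_dyson_le (x₀ : E) {c d K : ℝ} (ht₀ : t₀ ∈ Icc c d) (hK : ∀ t ∈ Icc c d, ‖L t‖ ≤ K)
    (n : ℕ) : ∀ t ∈ Icc c d, ‖dyson L t₀ x₀ n t‖ ≤ ‖x₀‖ * K ^ n * (|t - t₀| ^ n / n.factorial) := by
  have hK0 : 0 ≤ K := (norm_nonneg _).trans (hK t₀ ht₀)
  induction n with
  | zero => intro t _; simp [dyson]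
  | succ n ih =>
    intro t ht
    have hsub : uIoc t₀ t ⊆ Icc c d := uIoc_subset_uIcc.trans (uIcc_subset_Icc ht₀ ht)
    have h1 : ‖dyson L t₀ x₀ (n + 1) t‖
        ≤ ∫ s in uIoc t₀ t, (‖x₀‖ * K ^ (n + 1) / n.factorial) * |s - t₀| ^ n := by
      rw [dyson, intervalIntegral.norm_intervalIntegral_eq]
      refine norm_integral_le_of_norm_le (Continuous.integrableOn_uIoc (by fun_prop)) ?_
      refine (ae_restrict_iff' measurableSet_uIoc).2 (.of_forall fun s hs => ?_)
      calc ‖L s (dyson L t₀ x₀ n s)‖ ≤ ‖L s‖ * ‖dyson L t₀ x₀ n s‖ := (L s).le_opNorm _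
        _ ≤ K * (‖x₀‖ * K ^ n * (|s - t₀| ^ n / n.factorial)) :=
          mul_le_mul (hK s (hsub hs)) (ih s (hsub hs)) (norm_nonneg _) hK0
        _ = _ := by ring
    refine h1.trans_eq ?_
    rw [integral_const_mul, integral_pow_abs_sub_uIoc, Nat.factorial_succ]
    have : (n.factorial : ℝ) ≠ 0 := by positivity
    push_cast
    field_simp

/-- A linear differential equation with continuous coefficients has a solution on the whole open
interval on which the coefficients are given. -/
theorem exists_hasDerivAt_linear (hI : IsOpen I) (hc : I.OrdConnected) (hL : ContinuousOn L I)
    (ht₀ : t₀ ∈ I) (x₀ : E) :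
    ∃ x : ℝ → E, x t₀ = x₀ ∧ ∀ t ∈ I, HasDerivAt x (L t (x t)) t := by
  have hzero : ∀ n, dyson L t₀ x₀ (n + 1) t₀ = 0 := fun n => by simp [dyson]
  refine ⟨fun t => x₀ + ∑' n, dyson L t₀ x₀ (n + 1) t, by simp [hzero], fun t ht => ?_⟩
  -- `L` need not be bounded on `I`. Convergence is checked on a compact interval around `t₀` and
  -- `t`, while the series itself does not depend on that interval.
  obtain ⟨c, d, h₀, h₁, hsub⟩ := exists_Icc_subset hI hc ht₀ ht
  obtain ⟨K, hK⟩ := isCompact_Icc.exists_bound_of_continuousOn (hL.mono hsub)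
  have hK0 : 0 ≤ K := (norm_nonneg _).trans (hK t₀ (Ioo_subset_Icc_self h₀))
  have hbound : ∀ n, ∀ s ∈ Icc c d,
      ‖dyson L t₀ x₀ n s‖ ≤ ‖x₀‖ * ((K * (d - c)) ^ n / n.factorial) := by
    intro n s hs
    refine (norm_dyson_le x₀ (Ioo_subset_Icc_self h₀) hK n s hs).trans ?_
    have hd : |s - t₀| ≤ d - c := abs_sub_le_iff.2
      ⟨by linarith [hs.2, h₀.1], by linarith [hs.1, h₀.2]⟩
    calc ‖x₀‖ * K ^ n * (|s - t₀| ^ n / n.factorial)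
        ≤ ‖x₀‖ * K ^ n * ((d - c) ^ n / n.factorial) := by gcongr
      _ = _ := by rw [mul_pow]; ring
  have hsum : Summable fun n : ℕ => ‖x₀‖ * ((K * (d - c)) ^ n / n.factorial) :=
    (Real.summable_pow_div_factorial _).mul_left _
  have hder := hasDerivAt_tsum_of_isPreconnected (u := fun n : ℕ =>
      K * (‖x₀‖ * ((K * (d - c)) ^ n / n.factorial))) (hsum.mul_left K)
    (isOpen_Ioo (a := c) (b := d)) isPreconnected_Ioo
    (g := fun n => dyson L t₀ x₀ (n + 1)) (g' := fun n s => L s (dyson L t₀ x₀ n s))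
    (fun n s hs => dyson_hasDerivAt hI hc hL ht₀ x₀ n (hsub (Ioo_subset_Icc_self hs)))
    (fun n s hs => ((L s).le_opNorm _).trans (mul_le_mul (hK s (Ioo_subset_Icc_self hs))
      (hbound n s (Ioo_subset_Icc_self hs)) (norm_nonneg _) hK0))
    h₀ (by simp [hzero, summable_zero]) h₁
  have hsum' : Summable fun n => dyson L t₀ x₀ n t :=
    Summable.of_norm_bounded hsum fun n => hbound n t (Ioo_subset_Icc_self h₁)
  -- The derivative of term n + 1 is `L` applied to term n, so the differentiated series starts at
  -- index 0, where the term is `x₀`.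
  have heq : L t (x₀ + ∑' n, dyson L t₀ x₀ (n + 1) t) = ∑' n, L t (dyson L t₀ x₀ n t) := by
    rw [← (L t).map_tsum hsum', hsum'.tsum_eq_zero_add]
    rfl
  rw [heq]
  exact hder.const_add x₀

end LinearODE

/-! ### The first variation of a quadratic energy -/

section Variation

variable {E F : Type*} [NormedAddCommGroup E] [NormedSpace ℝ E]
  [NormedAddCommGroup F] [NormedSpace ℝ F]

/-- Differentiation under the integral sign for a `C¹` integrand. -/
theorem hasDerivAt_integral_of_contDiffOn [CompleteSpace E] {I : Set ℝ} (hI : IsOpen I)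
    {δ : ℝ} (hδ : 0 < δ)
    {f : ℝ × ℝ → E} (hf : ContDiffOn ℝ 1 f (Ioo (-δ) δ ×ˢ I)) {a b : ℝ} (hab : a ≤ b)
    (hsub : Icc a b ⊆ I) :
    HasDerivAt (fun ε => ∫ t in a..b, f (ε, t)) (∫ t in a..b, fderiv ℝ f (0, t) (1, 0)) 0 := by
  have hU : IsOpen (Ioo (-δ) δ ×ˢ I) := isOpen_Ioo.prod hI
  -- Halving `δ` gives a compact rectangle, on which the ε-derivative is bounded; the constant bound
  -- serves as dominating function.
  have hcomp : IsCompact (Icc (-(δ / 2)) (δ / 2) ×ˢ Icc a b) := isCompact_Icc.prod isCompact_Icc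
  have hsub' : Icc (-(δ / 2)) (δ / 2) ×ˢ Icc a b ⊆ Ioo (-δ) δ ×ˢ I :=
    prod_mono (fun x hx => ⟨by linarith [hx.1], by linarith [hx.2]⟩) hsub
  have hc : ContinuousOn (fun q => fderiv ℝ f q (1, 0)) (Ioo (-δ) δ ×ˢ I) :=
    (hf.continuousOn_fderiv_of_isOpen hU le_rfl).clm_apply continuousOn_const
  obtain ⟨C, hC⟩ := hcomp.exists_bound_of_continuousOn (hc.mono hsub')
  have huI : uIoc a b ⊆ Icc a b := by rw [uIoc_of_le hab]; exact Ioc_subset_Icc_self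
  have hslice : ∀ {G : ℝ × ℝ → E}, ContinuousOn G (Ioo (-δ) δ ×ˢ I) → ∀ ε ∈ Ioo (-δ) δ,
      ContinuousOn (fun t => G (ε, t)) (Icc a b) := fun hG ε hε =>
    hG.comp (by fun_prop) fun t ht => ⟨hε, hsub ht⟩
  have h0 : (0 : ℝ) ∈ Ioo (-δ) δ := ⟨by linarith, hδ⟩
  refine (intervalIntegral.hasDerivAt_integral_of_dominated_loc_of_deriv_le (μ := volume)
    (F := fun ε t => f (ε, t)) (F' := fun ε t => fderiv ℝ f (ε, t) (1, 0)) (bound := fun _ => C)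
    (s := Icc (-(δ / 2)) (δ / 2)) (Icc_mem_nhds (by linarith) (by linarith)) ?_ ?_ ?_ ?_ ?_ ?_).2
  · filter_upwards [Ioo_mem_nhds h0.1 h0.2] with ε hε
    exact ((hslice hf.continuousOn ε hε).mono huI).aestronglyMeasurable measurableSet_uIoc
  · apply ContinuousOn.intervalIntegrable
    rw [uIcc_of_le hab]
    exact hslice hf.continuousOn 0 h0
  · exact ((hslice hc 0 h0).mono huI).aestronglyMeasurable measurableSet_uIoc
  · exact .of_forall fun t ht ε hε => hC (ε, t) ⟨hε, huI ht⟩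
  · exact intervalIntegrable_const
  · refine .of_forall fun t ht ε hε => ?_
    have hq : ((ε, t) : ℝ × ℝ) ∈ Ioo (-δ) δ ×ˢ I := hsub' ⟨hε, huI ht⟩
    have h1 : HasFDerivAt f (fderiv ℝ f (ε, t)) (ε, t) :=
      ((hf.contDiffAt (hU.mem_nhds hq)).differentiableAt one_ne_zero).hasFDerivAt
    have h2 : HasDerivAt (fun x : ℝ => (x, t)) ((1 : ℝ), (0 : ℝ)) ε :=
      (hasDerivAt_id ε).prodMk (hasDerivAt_const ε t)
    exact h1.comp_hasDerivAt ε h2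

theorem hasDerivAt_slice_left {f : ℝ × ℝ → E} {q : ℝ × ℝ} (hf : DifferentiableAt ℝ f q) :
    HasDerivAt (fun ε => f (ε, q.2)) (fderiv ℝ f q (1, 0)) q.1 :=
  HasFDerivAt.comp_hasDerivAt (f := fun x : ℝ => (x, q.2)) q.1 hf.hasFDerivAt
    ((hasDerivAt_id q.1).prodMk (hasDerivAt_const q.1 q.2))

theorem hasDerivAt_slice_right {f : ℝ × ℝ → E} {q : ℝ × ℝ} (hf : DifferentiableAt ℝ f q) :
    HasDerivAt (fun t => f (q.1, t)) (fderiv ℝ f q (0, 1)) q.2 :=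
  HasFDerivAt.comp_hasDerivAt (f := fun x : ℝ => (q.1, x)) q.2 hf.hasFDerivAt
    ((hasDerivAt_const q.2 q.1).prodMk (hasDerivAt_id q.2))

theorem fderiv_affine_bilinear (P : E →L[ℝ] F) (B : E →L[ℝ] E →L[ℝ] F)
    {u w : ℝ × ℝ → E} {q : ℝ × ℝ} (hu : DifferentiableAt ℝ u q) (hw : DifferentiableAt ℝ w q)
    (v : ℝ × ℝ) :
    fderiv ℝ (fun q => P (w q) + B (u q) (w q)) q v
      = P (fderiv ℝ w q v) + (B (u q) (fderiv ℝ w q v) + B (fderiv ℝ u q v) (w q)) := by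
  have h1 := P.hasFDerivAt.comp q hw.hasFDerivAt
  have h2 := B.hasFDerivAt_of_bilinear hu.hasFDerivAt hw.hasFDerivAt
  have h3 : HasFDerivAt (fun q => P (w q) + B (u q) (w q)) _ q := h1.add h2
  rw [h3.fderiv]
  simp

theorem _root_.ContDiffOn.differentiableAt_of_isOpen {U : Set E} (hU : IsOpen U) {f : E → F}
    (hf : ContDiffOn ℝ 1 f U) {q : E} (hq : q ∈ U) : DifferentiableAt ℝ f q :=
  (hf.contDiffAt (hU.mem_nhds hq)).differentiableAt one_ne_zero

/-- The first variation of the energy `∫ ½ Q(ξ, ξ)` with `ξ = P u_t + B(u, u_t)`. -/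
theorem hasDerivAt_energy [CompleteSpace E] [CompleteSpace F] (P : E →L[ℝ] F)
    (B : E →L[ℝ] E →L[ℝ] F)
    (Q : F →L[ℝ] F →L[ℝ] ℝ) (hQ : ∀ x y, Q x y = Q y x) {I : Set ℝ} (hI : IsOpen I)
    {δ : ℝ} (hδ : 0 < δ)
    {u : ℝ × ℝ → E} (hu : ContDiffOn ℝ 2 u (Ioo (-δ) δ ×ˢ I)) {a b : ℝ} (hab : a ≤ b)
    (hsub : Icc a b ⊆ I) (ha : ∀ ε ∈ Ioo (-δ) δ, u (ε, a) = u (0, a))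
    (hb : ∀ ε ∈ Ioo (-δ) δ, u (ε, b) = u (0, b)) {ut uε : ℝ × ℝ → E} {ξ η : ℝ × ℝ → F}
    (hut : ut = fun q => fderiv ℝ u q (0, 1)) (huε : uε = fun q => fderiv ℝ u q (1, 0))
    (hξ : ξ = fun q => P (ut q) + B (u q) (ut q)) (hη : η = fun q => P (uε q) + B (u q) (uε q)) :
    HasDerivAt (fun ε => ∫ t in a..b, 1 / 2 * Q (ξ (ε, t)) (ξ (ε, t)))
      (∫ t in a..b, (Q (ξ (0, t)) (B (uε (0, t)) (ut (0, t)) - B (ut (0, t)) (uε (0, t)))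
        - Q (deriv (fun s => ξ (0, s)) t) (η (0, t)))) 0 := by
  have hU : IsOpen (Ioo (-δ) δ ×ˢ I) := isOpen_Ioo.prod hI
  have h0 : (0 : ℝ) ∈ Ioo (-δ) δ := ⟨by linarith, hδ⟩
  have hut1 : ContDiffOn ℝ 1 ut (Ioo (-δ) δ ×ˢ I) := by
    rw [hut]; exact (hu.fderiv_of_isOpen hU (by norm_num)).clm_apply contDiffOn_const
  have huε1 : ContDiffOn ℝ 1 uε (Ioo (-δ) δ ×ˢ I) := by
    rw [huε]; exact (hu.fderiv_of_isOpen hU (by norm_num)).clm_apply contDiffOn_const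
  have hu1 : ContDiffOn ℝ 1 u (Ioo (-δ) δ ×ˢ I) := hu.of_le (by norm_num)
  have hξ1 : ContDiffOn ℝ 1 ξ (Ioo (-δ) δ ×ˢ I) := by
    rw [hξ]
    exact (P.contDiff.comp_contDiffOn hut1).add ((B.contDiff.comp_contDiffOn hu1).clm_apply hut1)
  have hη1 : ContDiffOn ℝ 1 η (Ioo (-δ) δ ×ˢ I) := by
    rw [hη]
    exact (P.contDiff.comp_contDiffOn huε1).add ((B.contDiff.comp_contDiffOn hu1).clm_apply huε1)
  have hint := hasDerivAt_integral_of_contDiffOn hI hδ (f := fun q => 1 / 2 * Q (ξ q) (ξ q))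
    (contDiffOn_const.mul ((Q.contDiff.comp_contDiffOn hξ1).clm_apply hξ1)) hab hsub
  convert! hint using 1
  have hsymm : ∀ q ∈ Ioo (-δ) δ ×ˢ I, fderiv ℝ ut q (1, 0) = fderiv ℝ uε q (0, 1) := by
    intro q hq
    have hs := (hu.contDiffAt (hU.mem_nhds hq)).isSymmSndFDerivAt (by simp)
    have hdu : DifferentiableAt ℝ (fderiv ℝ u) q :=
      ((hu.fderiv_of_isOpen hU (m := 1) (by norm_num)).contDiffAt
        (hU.mem_nhds hq)).differentiableAt one_ne_zero
    rw [hut, huε, fderiv_clm_apply hdu (by fun_prop), fderiv_clm_apply hdu (by fun_prop)]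
    simpa using hs (1, 0) (0, 1)
  -- The second derivatives of `u` cancel by symmetry, both under `P` and in the second slot of `B`.
  -- What remains is the antisymmetrisation of `B`.
  have hξη : ∀ q ∈ Ioo (-δ) δ ×ˢ I, fderiv ℝ ξ q (1, 0)
      = fderiv ℝ η q (0, 1) + (B (uε q) (ut q) - B (ut q) (uε q)) := by
    intro q hq
    have e1 : fderiv ℝ u q (1, 0) = uε q := by rw [huε]
    have e2 : fderiv ℝ u q (0, 1) = ut q := by rw [hut]
    rw [hξ, hη, fderiv_affine_bilinear P B (hu1.differentiableAt_of_isOpen hU hq) (hut1.differentiableAt_of_isOpen hU hq),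
      fderiv_affine_bilinear P B (hu1.differentiableAt_of_isOpen hU hq) (huε1.differentiableAt_of_isOpen hU hq), hsymm q hq, e1, e2]
    abel
  -- Where the variation is fixed, u_ε = 0, and η is linear in u_ε.
  have hbd : ∀ t, (∀ ε ∈ Ioo (-δ) δ, u (ε, t) = u (0, t)) → t ∈ I → η (0, t) = 0 := by
    intro t ht htI
    have h1 : HasDerivAt (fun ε => u (ε, t)) (uε (0, t)) 0 := by
      rw [huε]
      exact hasDerivAt_slice_left (hu1.differentiableAt_of_isOpen hU (q := (0, t)) ⟨h0, htI⟩)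
    have h2 : HasDerivAt (fun ε => u (ε, t)) 0 0 :=
      (hasDerivAt_const (0 : ℝ) (u (0, t))).congr_of_eventuallyEq
        (eventually_of_mem (Ioo_mem_nhds h0.1 h0.2) ht)
    rw [hη]
    simp [h1.unique h2]
  have hmem : ∀ t ∈ Icc a b, ((0 : ℝ), t) ∈ Ioo (-δ) δ ×ˢ I := fun t ht => ⟨h0, hsub ht⟩
  have hξt : ∀ t ∈ Icc a b, HasDerivAt (fun s => ξ (0, s)) (fderiv ℝ ξ (0, t) (0, 1)) t :=
    fun t ht => hasDerivAt_slice_right (hξ1.differentiableAt_of_isOpen hU (hmem t ht))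
  have hηt : ∀ t ∈ Icc a b, HasDerivAt (fun s => η (0, s)) (fderiv ℝ η (0, t) (0, 1)) t :=
    fun t ht => hasDerivAt_slice_right (hη1.differentiableAt_of_isOpen hU (hmem t ht))
  have hslice : MapsTo (fun t : ℝ => ((0 : ℝ), t)) (Icc a b) (Ioo (-δ) δ ×ˢ I) := hmem
  have hcF : ∀ {G : ℝ × ℝ → F},
      ContinuousOn G (Ioo (-δ) δ ×ˢ I) → ContinuousOn (fun t => G (0, t)) (Icc a b) :=
    fun hG => hG.comp (by fun_prop) hslice
  have hcE : ∀ {G : ℝ × ℝ → E},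
      ContinuousOn G (Ioo (-δ) δ ×ˢ I) → ContinuousOn (fun t => G (0, t)) (Icc a b) :=
    fun hG => hG.comp (by fun_prop) hslice
  have hQt : ∀ t ∈ Icc a b, HasDerivAt (fun s => Q (ξ (0, s)) (η (0, s)))
      (Q (ξ (0, t)) (fderiv ℝ η (0, t) (0, 1)) + Q (fderiv ℝ ξ (0, t) (0, 1)) (η (0, t))) t :=
    fun t ht => Q.hasDerivAt_of_bilinear (fun _ => hξt t ht) (fun _ => hηt t ht)
  have hcξ := hcF ((hξ1.continuousOn_fderiv_of_isOpen hU le_rfl).clm_apply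
    (continuousOn_const (c := ((0 : ℝ), (1 : ℝ)))))
  have hcη := hcF ((hη1.continuousOn_fderiv_of_isOpen hU le_rfl).clm_apply
    (continuousOn_const (c := ((0 : ℝ), (1 : ℝ)))))
  have hQξη := (Q.continuous.comp_continuousOn hcξ).clm_apply (hcF hη1.continuousOn)
  have hint1 : IntervalIntegrable (fun t => Q (ξ (0, t)) (fderiv ℝ η (0, t) (0, 1))
      + Q (fderiv ℝ ξ (0, t) (0, 1)) (η (0, t))) volume a b := by
    apply ContinuousOn.intervalIntegrable
    rw [uIcc_of_le hab]
    exact ((Q.continuous.comp_continuousOn (hcF hξ1.continuousOn)).clm_apply hcη).add hQξη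
  have hint2 : IntervalIntegrable (fun t =>
      Q (ξ (0, t)) (B (uε (0, t)) (ut (0, t)) - B (ut (0, t)) (uε (0, t)))
        - Q (fderiv ℝ ξ (0, t) (0, 1)) (η (0, t))) volume a b := by
    apply ContinuousOn.intervalIntegrable
    rw [uIcc_of_le hab]
    have c1 := hcE hut1.continuousOn
    have c2 := hcE huε1.continuousOn
    exact ((Q.continuous.comp_continuousOn (hcF hξ1.continuousOn)).clm_apply
      (((B.continuous.comp_continuousOn c2).clm_apply c1).sub
        ((B.continuous.comp_continuousOn c1).clm_apply c2))).sub hQξη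
  have hpart : ∫ t in a..b, (Q (ξ (0, t)) (fderiv ℝ η (0, t) (0, 1))
      + Q (fderiv ℝ ξ (0, t) (0, 1)) (η (0, t))) = 0 := by
    rw [intervalIntegral.integral_eq_sub_of_hasDerivAt (f := fun t => Q (ξ (0, t)) (η (0, t)))
      (fun t ht => hQt t (uIcc_of_le hab ▸ ht)) hint1, hbd a ha (hsub ⟨le_rfl, hab⟩),
      hbd b hb (hsub ⟨hab, le_rfl⟩)]
    simp
  -- The total derivative of Q(ξ, η) is split off; its integral is the boundary term just shown to
  -- vanish.
  have hsplit : ∫ t in a..b, fderiv ℝ (fun q => 1 / 2 * Q (ξ q) (ξ q)) (0, t) (1, 0)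
      = ∫ t in a..b, ((Q (ξ (0, t)) (fderiv ℝ η (0, t) (0, 1))
          + Q (fderiv ℝ ξ (0, t) (0, 1)) (η (0, t)))
        + (Q (ξ (0, t)) (B (uε (0, t)) (ut (0, t)) - B (ut (0, t)) (uε (0, t)))
          - Q (fderiv ℝ ξ (0, t) (0, 1)) (η (0, t)))) := by
    refine intervalIntegral.integral_congr fun t ht => ?_
    rw [uIcc_of_le hab] at ht
    have hξd := (hξ1.differentiableAt_of_isOpen hU (hmem t ht)).hasFDerivAt
    have h1 := (Q.hasFDerivAt_of_bilinear hξd hξd).const_mul (1 / 2 : ℝ)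
    rw [h1.fderiv]
    simp only [smul_apply, add_apply, ContinuousLinearMap.precompR_apply,
      ContinuousLinearMap.precompL_apply, ContinuousLinearMap.compL_apply,
      ContinuousLinearMap.comp_apply, smul_eq_mul]
    rw [hQ (fderiv ℝ ξ (0, t) (1, 0)), hξη _ (hmem t ht), map_add]
    ring
  rw [hsplit, intervalIntegral.integral_add hint1 hint2, hpart, zero_add]
  refine intervalIntegral.integral_congr fun t ht => ?_
  rw [(hξt t (uIcc_of_le hab ▸ ht)).deriv]

/-- A continuous function is zero if it is orthogonal to `t ↦ (t - a) (b - t)` on all `[a, b]`. -/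
theorem eq_zero_of_forall_integral_eq_zero {I : Set ℝ} (hI : IsOpen I) {f : ℝ → ℝ}
    (hf : ContinuousOn f I)
    (h : ∀ a b, a < b → Icc a b ⊆ I → ∫ t in a..b, (t - a) * (b - t) * f t = 0) :
    ∀ t ∈ I, f t = 0 := by
  -- Near a point where `g` is positive the weight makes the integral positive. Applying this to f
  -- and −f excludes both signs.
  have key : ∀ g : ℝ → ℝ, ContinuousOn g I →
      (∀ a b, a < b → Icc a b ⊆ I → ∫ t in a..b, (t - a) * (b - t) * g t = 0) →
      ∀ t ∈ I, g t ≤ 0 := by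
    intro g hg hint t ht
    by_contra! hpos
    obtain ⟨e, he, hball⟩ := Metric.mem_nhds_iff.1 (Filter.inter_mem (hI.mem_nhds ht)
      ((hg.continuousAt (hI.mem_nhds ht)).eventually (lt_mem_nhds hpos)))
    have hsub : Icc (t - e / 2) (t + e / 2) ⊆ I ∩ {x | 0 < g x} := fun x hx => hball (by
      rw [Metric.mem_ball, Real.dist_eq, abs_lt]
      constructor <;> linarith [hx.1, hx.2])
    have hlt : t - e / 2 < t + e / 2 := by linarith
    refine (intervalIntegral.intervalIntegral_pos_of_pos_on ?_ (fun x hx => ?_) hlt).ne'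
      (hint _ _ hlt (hsub.trans inter_subset_left))
    · apply ContinuousOn.intervalIntegrable
      rw [uIcc_of_le hlt.le]
      exact ContinuousOn.mul (by fun_prop) (hg.mono (hsub.trans inter_subset_left))
    · have := (hsub (Ioo_subset_Icc_self hx)).2
      exact mul_pos (mul_pos (sub_pos.2 hx.1) (sub_pos.2 hx.2)) this
  intro t ht
  refine le_antisymm (key f hf h t ht) (neg_nonpos.1 (key (fun s => - f s) hf.neg ?_ t ht))
  intro a b hab hsub
  simp [h a b hab hsub]

end Variation


/-! ### The normal form of an antisymmetric matrix -/

section NormalForm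

/-- An orthonormal eigenbasis of NᵀN, ordered with the nonzero eigenvalues first, works: its null
eigenvectors span the kernel of N, and antisymmetry then kills the corresponding rows as well as the
columns. -/
theorem exists_orthogonal_fromBlocks {r d n : ℕ} {N : Matrix (Fin n) (Fin n) ℝ} (hN : Nᵀ = -N)
    (hr : N.rank = r) (hd : r + d = n) :
    ∃ (O : Matrix (Fin n) (Fin r ⊕ Fin d) ℝ) (Nb : Matrix (Fin r) (Fin r) ℝ),
      Oᵀ * O = 1 ∧ O * Oᵀ = 1 ∧ IsUnit Nb ∧
        N = O * Matrix.fromBlocks Nb 0 0 (0 : Matrix (Fin d) (Fin d) ℝ) * Oᵀ := by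
  have hM : (Nᵀ * N).IsHermitian := by
    simpa [Matrix.conjTranspose_eq_transpose_of_trivial] using
      Matrix.isHermitian_conjTranspose_mul_self N
  have hcard : Fintype.card {i // hM.eigenvalues i ≠ 0} = r := by
    rw [← hM.rank_eq_card_non_zero_eigs, Matrix.rank_transpose_mul_self, hr]
  have hcard' : Fintype.card {i // ¬ hM.eigenvalues i ≠ 0} = d := by
    rw [Fintype.card_subtype_compl, hcard, Fintype.card_fin]; omega
  let e : Fin r ⊕ Fin d ≃ Fin n :=
    (Equiv.sumCongr (Fintype.equivFinOfCardEq hcard).symm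
      (Fintype.equivFinOfCardEq hcard').symm).trans (Equiv.sumCompl _)
  have hinl : ∀ i, hM.eigenvalues (e (.inl i)) ≠ 0 := fun i =>
    ((Fintype.equivFinOfCardEq hcard).symm i).2
  have hinr : ∀ j, hM.eigenvalues (e (.inr j)) = 0 := fun j =>
    not_not.1 ((Fintype.equivFinOfCardEq hcard').symm j).2
  set U : Matrix (Fin n) (Fin n) ℝ := (hM.eigenvectorUnitary : Matrix (Fin n) (Fin n) ℝ) with hUdef
  have hUU : Uᵀ * U = 1 := by
    have := Unitary.coe_star_mul_self hM.eigenvectorUnitary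
    rwa [Matrix.star_eq_conjTranspose, Matrix.conjTranspose_eq_transpose_of_trivial] at this
  have hUU' : U * Uᵀ = 1 := mul_eq_one_comm.1 hUU
  have hdiag : Uᵀ * (Nᵀ * N) * U = Matrix.diagonal hM.eigenvalues := by
    have h := hM.spectral_theorem
    rw [Unitary.conjStarAlgAut_apply, Matrix.star_eq_conjTranspose,
      Matrix.conjTranspose_eq_transpose_of_trivial, ← hUdef] at h
    calc Uᵀ * (Nᵀ * N) * U
        = Uᵀ * (U * Matrix.diagonal (RCLike.ofReal ∘ hM.eigenvalues) * Uᵀ) * U := by rw [← h]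
      _ = (Uᵀ * U) * Matrix.diagonal (RCLike.ofReal ∘ hM.eigenvalues) * (Uᵀ * U) := by
          simp only [Matrix.mul_assoc]
      _ = _ := by rw [hUU, Matrix.one_mul, Matrix.mul_one]; rfl
  set O : Matrix (Fin n) (Fin r ⊕ Fin d) ℝ := U.submatrix id e with hO
  have hOO : Oᵀ * O = 1 := by
    rw [hO, Matrix.transpose_submatrix, ← Matrix.submatrix_mul _ _ _ _ _ Function.bijective_id,
      hUU, Matrix.submatrix_one_equiv]
  have hOO' : O * Oᵀ = 1 := by
    rw [hO, Matrix.transpose_submatrix, ← Matrix.submatrix_mul _ _ _ _ _ e.bijective,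
      hUU', Matrix.submatrix_id_id]
  set W := Oᵀ * N * O with hW
  have hWt : Wᵀ = -W := by
    simp only [hW, Matrix.transpose_mul, Matrix.transpose_transpose, hN, Matrix.mul_neg,
      Matrix.neg_mul, Matrix.mul_assoc]
  have hNW : N = O * W * Oᵀ := by
    calc N = (O * Oᵀ) * N * (O * Oᵀ) := by rw [hOO', Matrix.one_mul, Matrix.mul_one]
      _ = _ := by simp only [hW, Matrix.mul_assoc]
  have hWW : Wᵀ * W = Matrix.diagonal (hM.eigenvalues ∘ e) := by
    calc Wᵀ * W = Oᵀ * Nᵀ * (O * Oᵀ) * N * O := by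
          simp only [hW, Matrix.transpose_mul, Matrix.transpose_transpose, Matrix.mul_assoc]
      _ = Oᵀ * (Nᵀ * N) * O := by rw [hOO', Matrix.mul_one]; simp only [Matrix.mul_assoc]
      _ = (Uᵀ * (Nᵀ * N) * U).submatrix e e := by
          rw [hO, Matrix.transpose_submatrix]; rfl
      _ = _ := by rw [hdiag, Matrix.submatrix_diagonal_equiv]
  -- The diagonal entry of WᵀW at a null index is the sum of squares of a column of W.
  have hcol : ∀ x j, W x (.inr j) = 0 := by
    intro x j
    have h := congrFun (congrFun hWW (.inr j)) (.inr j)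
    rw [Matrix.diagonal_apply_eq, Matrix.mul_apply] at h
    simp only [Matrix.transpose_apply, Function.comp_apply, hinr] at h
    exact mul_self_eq_zero.1 ((Finset.sum_eq_zero_iff_of_nonneg
      (fun _ _ => mul_self_nonneg _)).1 h x (Finset.mem_univ _))
  have hrow : ∀ j x, W (.inr j) x = 0 := by
    intro j x
    have h := congrFun (congrFun hWt x) (.inr j)
    simpa [hcol] using h
  have hblock : W = Matrix.fromBlocks W.toBlocks₁₁ 0 0 0 := by
    ext (i | i) (j | j) <;> simp [hcol, hrow, Matrix.toBlocks₁₁]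
  refine ⟨O, W.toBlocks₁₁, hOO, hOO', ?_, by rw [← hblock]; exact hNW⟩
  -- The remaining block has Gram matrix diagonal with nonzero entries, so its determinant cannot
  -- vanish.
  have hP : W.toBlocks₁₁ᵀ * W.toBlocks₁₁
      = Matrix.diagonal fun i => hM.eigenvalues (e (.inl i)) := by
    rw [hblock, Matrix.fromBlocks_transpose, Matrix.fromBlocks_multiply] at hWW
    ext i j
    have h := congrFun (congrFun hWW (.inl i)) (.inl j)
    simpa [Matrix.diagonal_apply] using h
  rw [Matrix.isUnit_iff_isUnit_det, isUnit_iff_ne_zero]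
  intro h0
  have h := congrArg Matrix.det hP
  rw [Matrix.det_mul, h0, mul_zero, Matrix.det_diagonal] at h
  exact Finset.prod_ne_zero_iff.2 (fun i _ => hinl i) h.symm

theorem transpose_eq_neg_of_normalForm {m p ι : Type*} [Fintype m] [DecidableEq m] [Fintype p]
    [DecidableEq p] [Fintype ι] {N : Matrix ι ι ℝ} (hN : Nᵀ = -N) {O : Matrix ι (m ⊕ p) ℝ}
    {Nb : Matrix m m ℝ} (hO : Oᵀ * O = 1)
    (h : N = O * Matrix.fromBlocks Nb 0 0 (0 : Matrix p p ℝ) * Oᵀ) : Nbᵀ = -Nb := by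
  have hW : Oᵀ * N * O = Matrix.fromBlocks Nb 0 0 (0 : Matrix p p ℝ) := by
    calc Oᵀ * N * O = (Oᵀ * O) * Matrix.fromBlocks Nb 0 0 (0 : Matrix p p ℝ) * (Oᵀ * O) := by
          rw [h]; simp only [Matrix.mul_assoc]
      _ = _ := by rw [hO, Matrix.one_mul, Matrix.mul_one]
  have h1 : (Oᵀ * N * O)ᵀ = -(Oᵀ * N * O) := by
    simp only [Matrix.transpose_mul, Matrix.transpose_transpose, hN, Matrix.mul_neg,
      Matrix.neg_mul, Matrix.mul_assoc]
  rw [hW, Matrix.fromBlocks_transpose, Matrix.fromBlocks_neg, Matrix.fromBlocks_inj] at h1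
  exact h1.1

/-- In odd order, det A = det Aᵀ = −det A. -/
theorem even_card_of_isUnit {r : ℕ} {A : Matrix (Fin r) (Fin r) ℝ} (hA : Aᵀ = -A)
    (hu : IsUnit A) : Even r := by
  by_contra hodd
  have h := congrArg Matrix.det hA
  rw [Matrix.det_transpose, Matrix.det_neg, Fintype.card_fin,
    (Nat.not_even_iff_odd.1 hodd).neg_one_pow] at h
  have h0 := isUnit_iff_ne_zero.1 ((Matrix.isUnit_iff_isUnit_det A).1 hu)
  exact h0 (by linarith)

/-- The normal form of a real antisymmetric matrix under orthogonal congruence. -/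
theorem exists_normalForm {n d : ℕ} {N : Matrix (Fin n) (Fin n) ℝ} (hN : Nᵀ = -N)
    (hd : N.rank + d = n) :
    ∃ (k : ℕ) (O : Matrix (Fin n) (Fin (2 * k) ⊕ Fin d) ℝ)
        (Nb : Matrix (Fin (2 * k)) (Fin (2 * k)) ℝ),
      Oᵀ * O = 1 ∧ O * Oᵀ = 1 ∧ IsUnit Nb ∧
        N = O * Matrix.fromBlocks Nb 0 0 (0 : Matrix (Fin d) (Fin d) ℝ) * Oᵀ := by
  obtain ⟨r, hr⟩ : ∃ r, N.rank = r := ⟨_, rfl⟩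
  obtain ⟨O, Nb, h1, h2, h3, h4⟩ := exists_orthogonal_fromBlocks hN hr (hr ▸ hd)
  obtain ⟨k, hk⟩ := even_card_of_isUnit (transpose_eq_neg_of_normalForm hN h1 h4) h3
  obtain rfl : r = 2 * k := by omega
  exact ⟨k, O, Nb, h1, h2, h3, h4⟩

end NormalForm

/-! ### Symmetric matrices and the Lie algebra of the generalized Jacobi group -/

section Algebra

variable {m p ι : Type*} [Fintype m] [DecidableEq m] [Fintype p] [DecidableEq p]
  [Fintype ι] [DecidableEq ι] {Nb : Matrix m m ℝ} {O : Matrix ι (m ⊕ p) ℝ}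

/-- The block matrix that `toSym` conjugates by `O`. -/
noncomputable def blockSym (Nb : Matrix m m ℝ) (ξ : Ambient m p) : Matrix (m ⊕ p) (m ⊕ p) ℝ :=
  Matrix.fromBlocks (Nb⁻¹ * ξ.1) (Nb⁻¹ * ξ.2.1) (Nb⁻¹ * ξ.2.1)ᵀ ((2 : ℝ) • ξ.2.2)

theorem toSym_eq (O : Matrix ι (m ⊕ p) ℝ) (ξ : Ambient m p) :
    toSym O Nb ξ = O * blockSym Nb ξ * Oᵀ := rfl

theorem inv_transpose_eq_neg (hNb : Nbᵀ = -Nb) : (Nb⁻¹)ᵀ = -Nb⁻¹ := by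
  rw [Matrix.transpose_nonsing_inv, hNb]
  by_cases h : IsUnit Nb.det
  · refine Matrix.inv_eq_right_inv ?_
    rw [neg_mul_neg, Matrix.mul_nonsing_inv _ h]
  -- In the singular case both inverses are zero by convention.
  · have h' : ¬ IsUnit (-Nb).det := by rwa [← hNb, Matrix.det_transpose]
    rw [Matrix.nonsing_inv_apply_not_isUnit _ h, Matrix.nonsing_inv_apply_not_isUnit _ h', neg_zero]

/-- Since N̄⁻¹ is antisymmetric, being infinitesimally symplectic for −N̄⁻¹ is the same as N̄⁻¹S
being symmetric. This is why Θ takes symmetric values. -/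
theorem mem_jac_iff (hNb : Nbᵀ = -Nb) (ξ : Ambient m p) :
    ξ ∈ jac p (-Nb⁻¹) ↔ (Nb⁻¹ * ξ.1).IsSymm ∧ ξ.2.2.IsSymm := by
  have h : ξ ∈ jac p (-Nb⁻¹) ↔ -Nb⁻¹ * ξ.1 + ξ.1ᵀ * -Nb⁻¹ = 0 ∧ ξ.2.2.IsSymm := Iff.rfl
  rw [h]
  refine and_congr_left' ?_
  rw [Matrix.IsSymm, Matrix.transpose_mul, inv_transpose_eq_neg hNb, Matrix.neg_mul,
    neg_add_eq_zero, eq_comm]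

theorem blockSym_isSymm (hNb : Nbᵀ = -Nb) {ξ : Ambient m p} (hξ : ξ ∈ jac p (-Nb⁻¹)) :
    (blockSym Nb ξ).IsSymm := by
  obtain ⟨h1, h2⟩ := (mem_jac_iff hNb ξ).1 hξ
  exact Matrix.IsSymm.fromBlocks h1 rfl (h2.smul _)

theorem toSym_isSymm (hNb : Nbᵀ = -Nb) {ξ : Ambient m p} (hξ : ξ ∈ jac p (-Nb⁻¹)) :
    (toSym O Nb ξ).IsSymm := by
  rw [toSym_eq, Matrix.IsSymm, Matrix.transpose_mul, Matrix.transpose_mul,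
    Matrix.transpose_transpose, blockSym_isSymm hNb hξ, Matrix.mul_assoc]

/-- The triple with given image under `toSym`. -/
noncomputable def ofSym (O : Matrix ι (m ⊕ p) ℝ) (Nb : Matrix m m ℝ) (X : Matrix ι ι ℝ) : Ambient m p :=
  (Nb * (Oᵀ * X * O).toBlocks₁₁, Nb * (Oᵀ * X * O).toBlocks₁₂,
    (1 / 2 : ℝ) • (Oᵀ * X * O).toBlocks₂₂)

theorem ofSym_mem_jac (hu : IsUnit Nb) (hNb : Nbᵀ = -Nb) {X : Matrix ι ι ℝ} (hX : X.IsSymm) :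
    ofSym O Nb X ∈ jac p (-Nb⁻¹) := by
  have hdet := (Matrix.isUnit_iff_isUnit_det Nb).1 hu
  have hs : (Oᵀ * X * O).IsSymm := by
    rw [Matrix.IsSymm, Matrix.transpose_mul, Matrix.transpose_mul, Matrix.transpose_transpose,
      hX, Matrix.mul_assoc]
  rw [mem_jac_iff hNb]
  refine ⟨?_, ?_⟩
  · simp only [ofSym]
    rw [Matrix.nonsing_inv_mul_cancel_left _ _ hdet]
    ext i j
    exact hs.apply (.inl i) (.inl j)
  · refine Matrix.IsSymm.smul ?_ _
    ext i j
    exact hs.apply (.inr i) (.inr j)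

theorem toSym_ofSym (hu : IsUnit Nb) (hO : O * Oᵀ = 1) {X : Matrix ι ι ℝ} (hX : X.IsSymm) :
    toSym O Nb (ofSym O Nb X) = X := by
  have hdet := (Matrix.isUnit_iff_isUnit_det Nb).1 hu
  have hs : (Oᵀ * X * O).IsSymm := by
    rw [Matrix.IsSymm, Matrix.transpose_mul, Matrix.transpose_mul, Matrix.transpose_transpose,
      hX, Matrix.mul_assoc]
  have h21 : (Oᵀ * X * O).toBlocks₁₂ᵀ = (Oᵀ * X * O).toBlocks₂₁ := by
    ext i j
    exact hs.apply (.inr i) (.inl j)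
  have h : blockSym Nb (ofSym O Nb X) = Oᵀ * X * O := by
    rw [blockSym, ofSym, Matrix.nonsing_inv_mul_cancel_left _ _ hdet,
      Matrix.nonsing_inv_mul_cancel_left _ _ hdet, h21, smul_smul]
    norm_num [Matrix.fromBlocks_toBlocks]
  rw [toSym_eq, h]
  calc O * (Oᵀ * X * O) * Oᵀ = (O * Oᵀ) * X * (O * Oᵀ) := by simp only [Matrix.mul_assoc]
    _ = X := by rw [hO, Matrix.one_mul, Matrix.mul_one]

theorem ofSym_toSym (hu : IsUnit Nb) (hO : Oᵀ * O = 1) (ξ : Ambient m p) :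
    ofSym O Nb (toSym O Nb ξ) = ξ := by
  have hdet := (Matrix.isUnit_iff_isUnit_det Nb).1 hu
  have h : Oᵀ * toSym O Nb ξ * O = blockSym Nb ξ := by
    calc Oᵀ * (O * blockSym Nb ξ * Oᵀ) * O = (Oᵀ * O) * blockSym Nb ξ * (Oᵀ * O) := by
          simp only [Matrix.mul_assoc]
      _ = _ := by rw [hO, Matrix.one_mul, Matrix.mul_one]
  rw [ofSym, h, blockSym, Matrix.toBlocks_fromBlocks₁₁, Matrix.toBlocks_fromBlocks₁₂,
    Matrix.toBlocks_fromBlocks₂₂, Matrix.mul_nonsing_inv_cancel_left _ _ hdet,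
    Matrix.mul_nonsing_inv_cancel_left _ _ hdet, smul_smul]
  norm_num

theorem bijOn_toSym (hu : IsUnit Nb) (hNb : Nbᵀ = -Nb) (hO : Oᵀ * O = 1) (hO' : O * Oᵀ = 1) :
    Set.BijOn (toSym O Nb) (jac p (-Nb⁻¹)) {X | X.IsSymm} :=
  Set.InvOn.bijOn ⟨fun ξ _ => ofSym_toSym hu hO ξ, fun _ hX => toSym_ofSym hu hO' hX⟩
    (fun _ hξ => toSym_isSymm hNb hξ) (fun _ hX => ofSym_mem_jac hu hNb hX)

theorem trace_toSym_mul_toSym (hO : Oᵀ * O = 1) (ξ ζ : Ambient m p) :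
    (toSym O Nb ξ * toSym O Nb ζ).trace = (blockSym Nb ξ * blockSym Nb ζ).trace := by
  calc (O * blockSym Nb ξ * Oᵀ * (O * blockSym Nb ζ * Oᵀ)).trace
      = (O * (blockSym Nb ξ * (Oᵀ * O) * blockSym Nb ζ * Oᵀ)).trace := by
        simp only [Matrix.mul_assoc]
    _ = (blockSym Nb ξ * (Oᵀ * O) * blockSym Nb ζ * (Oᵀ * O)).trace := by
        rw [Matrix.trace_mul_comm]; simp only [Matrix.mul_assoc]
    _ = _ := by rw [hO, Matrix.mul_one, Matrix.mul_one]

/-- Because −N̄⁻² = (N̄⁻¹)ᵀ N̄⁻¹, the first two terms are squared Frobenius norms of blocks of Θξ.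
The off-diagonal block occurs twice in Tr((Θξ)²), and the corner 2B contributes 4 Tr(B²), which
accounts for the coefficients ½, 1 and 2. -/
theorem lagrangian_eq (hNb : Nbᵀ = -Nb) (hO : Oᵀ * O = 1) {ξ : Ambient m p}
    (hξ : ξ ∈ jac p (-Nb⁻¹)) :
    lagrangian Nb ξ = 1 / 2 * (toSym O Nb ξ * toSym O Nb ξ).trace := by
  obtain ⟨h1, h2⟩ := (mem_jac_iff hNb ξ).1 hξ
  have hJ := inv_transpose_eq_neg hNb
  have e1 : ξ.1ᵀ * (-(Nb⁻¹ * Nb⁻¹)) * ξ.1 = (Nb⁻¹ * ξ.1) * (Nb⁻¹ * ξ.1) := by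
    have h := h1.eq
    rw [Matrix.transpose_mul, hJ] at h
    nth_rw 1 [← h]
    simp only [Matrix.mul_neg, Matrix.neg_mul, Matrix.mul_assoc]
  have e2 : ξ.2.1ᵀ * (-(Nb⁻¹ * Nb⁻¹)) * ξ.2.1 = (Nb⁻¹ * ξ.2.1)ᵀ * (Nb⁻¹ * ξ.2.1) := by
    rw [Matrix.transpose_mul, hJ]
    simp only [Matrix.mul_neg, Matrix.neg_mul, Matrix.mul_assoc]
  have htr : ∀ (A : Matrix m m ℝ) (B : Matrix m p ℝ) (C : Matrix p m ℝ) (D : Matrix p p ℝ),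
      (Matrix.fromBlocks A B C D).trace = A.trace + D.trace := fun A B C D => by
    simp [Matrix.trace]
  rw [trace_toSym_mul_toSym hO, lagrangian, e1, e2, blockSym, Matrix.fromBlocks_multiply,
    htr, Matrix.trace_add, Matrix.trace_add,
    Matrix.trace_mul_comm (Nb⁻¹ * ξ.2.1)]
  simp only [Matrix.smul_mul, Matrix.mul_smul, Matrix.trace_smul, smul_eq_mul]
  ring

theorem trace_mul_self_pos {κ : Type*} [Fintype κ] {X : Matrix κ κ ℝ} (hX : X.IsSymm)
    (h0 : X ≠ 0) : 0 < (X * X).trace := by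
  nth_rw 1 [← hX.eq]
  refine lt_of_le_of_ne ?_ fun h => h0 ?_
  · simp only [Matrix.trace, Matrix.diag_apply, Matrix.mul_apply, Matrix.transpose_apply]
    exact Finset.sum_nonneg fun _ _ => Finset.sum_nonneg fun _ _ => mul_self_nonneg _
  · refine Matrix.trace_conjTranspose_mul_self_eq_zero_iff.1 ?_
    rw [Matrix.conjTranspose_eq_transpose_of_trivial, ← h]

theorem toSym_ne_zero (hu : IsUnit Nb) (hO : Oᵀ * O = 1) {ξ : Ambient m p} (h0 : ξ ≠ 0) :
    toSym O Nb ξ ≠ 0 := by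
  intro h
  apply h0
  rw [← ofSym_toSym hu hO ξ, h]
  ext <;> simp [ofSym, Matrix.toBlocks₁₁, Matrix.toBlocks₁₂, Matrix.toBlocks₂₂, Matrix.mul_apply]

theorem lagrangian_pos (hu : IsUnit Nb) (hNb : Nbᵀ = -Nb) (hO : Oᵀ * O = 1) {ξ : Ambient m p}
    (hξ : ξ ∈ jac p (-Nb⁻¹)) (h0 : ξ ≠ 0) : 0 < lagrangian Nb ξ := by
  rw [lagrangian_eq hNb hO hξ]
  have := trace_mul_self_pos (toSym_isSymm (O := O) hNb hξ) (toSym_ne_zero hu hO h0)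
  positivity

/-- The Lie bracket of the generalized Jacobi algebra. -/
noncomputable def bracket (Ω : Matrix m m ℝ) (ξ η : Ambient m p) : Ambient m p :=
  (ξ.1 * η.1 - η.1 * ξ.1, ξ.1 * η.2.1 - η.1 * ξ.2.1, (2 : ℝ) • cocycle Ω ξ.2.1 η.2.1)

/-- The map `toSym` carries the bracket to the bracket `X N Y - Y N X` of symmetric matrices. -/
theorem toSym_bracket (hu : IsUnit Nb) (hNb : Nbᵀ = -Nb) (hO : Oᵀ * O = 1) {N : Matrix ι ι ℝ}
    (hN : N = O * Matrix.fromBlocks Nb 0 0 (0 : Matrix p p ℝ) * Oᵀ) {ξ η : Ambient m p}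
    (hξ : ξ ∈ jac p (-Nb⁻¹)) (hη : η ∈ jac p (-Nb⁻¹)) :
    toSym O Nb (bracket (-Nb⁻¹) ξ η)
      = toSym O Nb ξ * N * toSym O Nb η - toSym O Nb η * N * toSym O Nb ξ := by
  have hdet := (Matrix.isUnit_iff_isUnit_det Nb).1 hu
  have hJ := inv_transpose_eq_neg hNb
  have hprod : ∀ ζ θ : Ambient m p, toSym O Nb ζ * N * toSym O Nb θ
      = O * (blockSym Nb ζ * Matrix.fromBlocks Nb 0 0 (0 : Matrix p p ℝ) * blockSym Nb θ) * Oᵀ := by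
    intro ζ θ
    calc O * blockSym Nb ζ * Oᵀ * N * (O * blockSym Nb θ * Oᵀ)
        = O * (blockSym Nb ζ * (Oᵀ * O) * Matrix.fromBlocks Nb 0 0 (0 : Matrix p p ℝ) * (Oᵀ * O)
            * blockSym Nb θ) * Oᵀ := by rw [hN]; simp only [Matrix.mul_assoc]
      _ = _ := by rw [hO, Matrix.mul_one, Matrix.mul_one]
  rw [hprod, hprod, ← Matrix.sub_mul, ← Matrix.mul_sub, toSym_eq]
  congr 2
  obtain ⟨hξ1, -⟩ := (mem_jac_iff hNb ξ).1 hξ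
  obtain ⟨hη1, -⟩ := (mem_jac_iff hNb η).1 hη
  -- Only the upper left block N̄ of the middle factor survives, and it cancels the N̄⁻¹ that begins
  -- the top blocks of the right factor.
  have hcan1 := fun A : Matrix m m ℝ => Matrix.mul_nonsing_inv_cancel_left Nb A hdet
  have hcan2 := fun A : Matrix m p ℝ => Matrix.mul_nonsing_inv_cancel_left Nb A hdet
  simp only [blockSym, bracket, Matrix.fromBlocks_multiply, Matrix.mul_zero, Matrix.zero_mul,
    add_zero, Matrix.mul_assoc, hcan1, hcan2]
  rw [sub_eq_add_neg (Matrix.fromBlocks _ _ _ _), Matrix.fromBlocks_neg, Matrix.fromBlocks_add]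
  simp only [← sub_eq_add_neg]
  congr 1
  · rw [Matrix.mul_sub]
  · rw [Matrix.mul_sub]
  -- The lower left block holds a transpose, so the symmetry of N̄⁻¹S is needed to match the two
  -- sides.
  · have h1 := hξ1.eq
    have h2 := hη1.eq
    rw [Matrix.transpose_mul, hJ] at h1 h2
    simp only [Matrix.mul_sub, Matrix.transpose_sub, Matrix.transpose_mul, hJ, Matrix.mul_assoc,
      h1, h2]
    simp only [Matrix.mul_neg, Matrix.neg_mul]
    abel
  · simp only [cocycle, symPart, Matrix.transpose_mul, Matrix.transpose_neg, hJ,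
      Matrix.transpose_transpose, Matrix.mul_neg, Matrix.neg_mul, neg_neg, Matrix.mul_assoc]
    module

/-- The Euler–Poincaré equation of the trace form is the Bloch–Iserles system. -/
theorem trace_mul_bracket (X Y N : Matrix ι ι ℝ) :
    (X * (X * N * Y - Y * N * X)).trace = ((X ^ 2 * N - N * X ^ 2) * Y).trace := by
  rw [Matrix.mul_sub, Matrix.sub_mul, Matrix.trace_sub, Matrix.trace_sub]
  congr 1
  · rw [pow_two]; simp only [Matrix.mul_assoc]
  · rw [pow_two, ← Matrix.mul_assoc, Matrix.trace_mul_comm, ← Matrix.mul_assoc,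
      ← Matrix.mul_assoc, Matrix.trace_mul_comm]
    simp only [Matrix.mul_assoc]

end Algebra


/-! ### Differentiation of matrix products -/

section MatrixCalculus

variable {l m p : Type*} [Fintype l] [Fintype m] [Fintype p]

/-- Matrix multiplication as a continuous bilinear map. -/
noncomputable def mulL (l m p : Type*) [Fintype l] [Fintype m] [Fintype p] :
    Matrix l m ℝ →L[ℝ] Matrix m p ℝ →L[ℝ] Matrix l p ℝ :=
  (LinearMap.mk₂ ℝ (fun (A : Matrix l m ℝ) (B : Matrix m p ℝ) => A * B) Matrix.add_mul
    (fun c A B => Matrix.smul_mul c A B) Matrix.mul_add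
    (fun c A B => Matrix.mul_smul A c B)).toContinuousBilinearMap

@[simp] theorem mulL_apply (A : Matrix l m ℝ) (B : Matrix m p ℝ) : mulL l m p A B = A * B := rfl

/-- Transposition as a continuous linear map. -/
noncomputable def transposeL (l m : Type*) [Fintype l] [Fintype m] : Matrix l m ℝ →L[ℝ] Matrix m l ℝ :=
  (Matrix.transposeLinearEquiv l m ℝ ℝ).toLinearMap.toContinuousLinearMap

@[simp] theorem transposeL_apply (A : Matrix l m ℝ) : transposeL l m A = Aᵀ := rfl

theorem _root_.ContDiffOn.bilinear {X E F G : Type*} [NormedAddCommGroup X] [NormedSpace ℝ X]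
    [NormedAddCommGroup E] [NormedSpace ℝ E] [NormedAddCommGroup F] [NormedSpace ℝ F]
    [NormedAddCommGroup G] [NormedSpace ℝ G] (B : E →L[ℝ] F →L[ℝ] G) {n : WithTop ℕ∞}
    {f : X → E} {g : X → F} {s : Set X} (hf : ContDiffOn ℝ n f s) (hg : ContDiffOn ℝ n g s) :
    ContDiffOn ℝ n (fun x => B (f x) (g x)) s :=
  (B.contDiff.comp_contDiffOn hf).clm_apply hg

theorem _root_.HasDerivAt.matrixMul {f : ℝ → Matrix l m ℝ} {g : ℝ → Matrix m p ℝ}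
    {f' : Matrix l m ℝ} {g' : Matrix m p ℝ} {t : ℝ} (hf : HasDerivAt f f' t)
    (hg : HasDerivAt g g' t) : HasDerivAt (fun s => f s * g s) (f t * g' + f' * g t) t :=
  (mulL l m p).hasDerivAt_of_bilinear (fun _ => hf) (fun _ => hg)

theorem _root_.HasDerivAt.matrixTranspose {f : ℝ → Matrix l m ℝ} {f' : Matrix l m ℝ} {t : ℝ}
    (hf : HasDerivAt f f' t) : HasDerivAt (fun s => (f s)ᵀ) f'ᵀ t :=
  (transposeL l m).hasFDerivAt.comp_hasDerivAt t hf

theorem _root_.ContDiffOn.matrixMul {E : Type*} [NormedAddCommGroup E] [NormedSpace ℝ E]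
    {n : WithTop ℕ∞} {f : E → Matrix l m ℝ} {g : E → Matrix m p ℝ} {s : Set E}
    (hf : ContDiffOn ℝ n f s) (hg : ContDiffOn ℝ n g s) :
    ContDiffOn ℝ n (fun x => f x * g x) s :=
  ContDiffOn.bilinear (mulL l m p) hf hg

end MatrixCalculus

/-! ### Left translation and the structure equation of the Jacobi group in matrix coordinates -/

section GroupCalculus

variable {m p : Type*} [Fintype m] [DecidableEq m] [Fintype p] [DecidableEq p]
  {Nb : Matrix m m ℝ}

theorem cocycle_smul_left (Ω : Matrix m m ℝ) (c : ℝ) (A C : Matrix m p ℝ) :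
    cocycle Ω (c • A) C = c • cocycle Ω A C := by
  simp only [cocycle, symPart, Matrix.transpose_smul, Matrix.smul_mul]
  module

theorem cocycle_smul_right (Ω : Matrix m m ℝ) (c : ℝ) (A C : Matrix m p ℝ) :
    cocycle Ω A (c • C) = c • cocycle Ω A C := by
  simp only [cocycle, symPart, Matrix.transpose_smul, Matrix.mul_smul]
  module

theorem cocycle_swap (hNb : Nbᵀ = -Nb) (A C : Matrix m p ℝ) :
    cocycle (-Nb⁻¹) A C = -cocycle (-Nb⁻¹) C A := by
  simp only [cocycle, symPart, Matrix.transpose_mul, Matrix.transpose_neg,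
    inv_transpose_eq_neg hNb, Matrix.transpose_transpose, Matrix.mul_neg, Matrix.neg_mul,
    Matrix.mul_assoc]
  module

/-- The cocycle as a continuous bilinear map. -/
noncomputable def cocycleL (p : Type*) [Fintype p] [DecidableEq p] (Ω : Matrix m m ℝ) :
    Matrix m p ℝ →L[ℝ] Matrix m p ℝ →L[ℝ] Matrix p p ℝ :=
  (LinearMap.mk₂ ℝ (cocycle Ω) (cocycle_add_left Ω) (cocycle_smul_left Ω) (cocycle_add_right Ω)
    (fun c A C => cocycle_smul_right Ω c A C)).toContinuousBilinearMap

@[simp] theorem cocycleL_apply (Ω : Matrix m m ℝ) (A C : Matrix m p ℝ) :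
    cocycleL p Ω A C = cocycle Ω A C := rfl

/-- The part of `(u, v) ↦ x⁻¹ v`, with `u = coords x`, that does not depend on `u`. -/
noncomputable def leftConst (m p : Type*) [Fintype m] [Fintype p] : Ambient m p →L[ℝ] Ambient m p :=
  (0 : Ambient m p →L[ℝ] Matrix m m ℝ).prod
    ((0 : Ambient m p →L[ℝ] Matrix m p ℝ).prod
      ((ContinuousLinearMap.snd ℝ (Matrix m p ℝ) (Matrix p p ℝ)).comp
        (ContinuousLinearMap.snd ℝ (Matrix m m ℝ) (Matrix m p ℝ × Matrix p p ℝ))))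

@[simp] theorem leftConst_apply (v : Ambient m p) : leftConst m p v = (0, 0, v.2.2) := rfl

/-- The part of `(u, v) ↦ x⁻¹ v`, with `u = coords x`, that is bilinear. -/
noncomputable def leftBilin (p : Type*) [Fintype p] [DecidableEq p] (Nb : Matrix m m ℝ) :
    Ambient m p →L[ℝ] Ambient m p →L[ℝ] Ambient m p :=
  (LinearMap.mk₂ ℝ (fun u v : Ambient m p => ((Nb * u.1ᵀ * Nb⁻¹ * v.1, Nb * u.1ᵀ * Nb⁻¹ * v.2.1,
      -cocycle (-Nb⁻¹) u.2.1 v.2.1) : Ambient m p))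
    (fun u u' v => by
      simp only [Prod.fst_add, Prod.snd_add, Matrix.transpose_add, Matrix.mul_add, Matrix.add_mul,
        cocycle_add_left, neg_add, Prod.mk_add_mk])
    (fun c u v => by
      simp only [Prod.smul_fst, Prod.smul_snd, Matrix.transpose_smul, Matrix.mul_smul,
        Matrix.smul_mul, cocycle_smul_left, smul_neg, Prod.smul_mk])
    (fun u v v' => by
      simp only [Prod.fst_add, Prod.snd_add, Matrix.mul_add,
        cocycle_add_right, neg_add, Prod.mk_add_mk])
    (fun c u v => by
      simp only [Prod.smul_fst, Prod.smul_snd, Matrix.mul_smul,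
        cocycle_smul_right, smul_neg, Prod.smul_mk])).toContinuousBilinearMap

@[simp] theorem leftBilin_apply (u v : Ambient m p) :
    leftBilin p Nb u v = (Nb * u.1ᵀ * Nb⁻¹ * v.1, Nb * u.1ᵀ * Nb⁻¹ * v.2.1,
      -cocycle (-Nb⁻¹) u.2.1 v.2.1) := rfl

/-- Left translation of the vector `v` at the point `u` to the identity. -/
noncomputable def leftForm (Nb : Matrix m m ℝ) (u v : Ambient m p) : Ambient m p :=
  leftConst m p v + leftBilin p Nb u v

theorem leftForm_eq (u v : Ambient m p) : leftForm Nb u v = (Nb * u.1ᵀ * Nb⁻¹ * v.1,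
    Nb * u.1ᵀ * Nb⁻¹ * v.2.1, v.2.2 - cocycle (-Nb⁻¹) u.2.1 v.2.1) := by
  simp [leftForm, sub_eq_add_neg]

theorem transpose_mul_inv_mul (g : Sp (-Nb⁻¹)) :
    (g : GL m ℝ).valᵀ * Nb⁻¹ * (g : GL m ℝ).val = Nb⁻¹ := by
  have h : (g : GL m ℝ).valᵀ * (-Nb⁻¹) * (g : GL m ℝ).val = -Nb⁻¹ := g.2
  simpa using h

theorem conj_transpose_mul (hu : IsUnit Nb) (g : Sp (-Nb⁻¹)) :
    Nb * (g : GL m ℝ).valᵀ * Nb⁻¹ * (g : GL m ℝ).val = 1 := by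
  rw [Matrix.mul_assoc Nb, Matrix.mul_assoc Nb, transpose_mul_inv_mul,
    Matrix.mul_nonsing_inv _ ((Matrix.isUnit_iff_isUnit_det Nb).1 hu)]

/-- The symplectic relation makes inversion linear in the entries of g. This is what lets left
translation be bilinear in coordinates. -/
theorem inv_val_eq (hu : IsUnit Nb) (g : Sp (-Nb⁻¹)) :
    ((g⁻¹ : Sp (-Nb⁻¹)) : GL m ℝ).val = Nb * (g : GL m ℝ).valᵀ * Nb⁻¹ := by
  have h2 : (g : GL m ℝ).val * ((g⁻¹ : Sp (-Nb⁻¹)) : GL m ℝ).val = 1 := by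
    rw [Subgroup.coe_inv, ← Units.val_mul, mul_inv_cancel, Units.val_one]
  exact (left_inv_eq_right_inv (conj_transpose_mul hu g) h2).symm

theorem coords_mul {Ω : Matrix m m ℝ} (x y : Jac p Ω) :
    (x * y).coords = (x.coords.1 * y.coords.1, x.coords.2.1 + x.coords.1 * y.coords.2.1,
      x.coords.2.2 + y.coords.2.2 + cocycle Ω x.coords.2.1 (x.coords.1 * y.coords.2.1)) := by
  simp [Jac.coords, spAction]

/-- For fixed x, left translation by x⁻¹ is affine in the coordinates of y, so its derivative is the
linear part `leftForm`. Invariance of the cocycle under Sp removes g from the last component. -/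
theorem coords_inv_mul (hu : IsUnit Nb) (x y : Jac p (-Nb⁻¹)) :
    (x⁻¹ * y).coords = leftForm Nb x.coords y.coords
      + (0, x⁻¹.coords.2.1, x⁻¹.coords.2.2) := by
  have h1 : x⁻¹.coords.1 = Nb * x.coords.1ᵀ * Nb⁻¹ := inv_val_eq hu x.right
  have h2 : x⁻¹.coords.2.1 = -(x⁻¹.coords.1 * x.coords.2.1) := by
    simp [Jac.coords, spAction]
  have h3 : cocycle (-Nb⁻¹) x⁻¹.coords.2.1 (x⁻¹.coords.1 * y.coords.2.1)
      = -cocycle (-Nb⁻¹) x.coords.2.1 y.coords.2.1 := by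
    rw [h2, cocycle_neg_left]
    exact congrArg _ (cocycle_sp (-Nb⁻¹) (x⁻¹).right x.coords.2.1 y.coords.2.1)
  rw [coords_mul, h3, leftForm_eq, h1]
  simp only [Prod.mk_add_mk, add_zero, Prod.mk.injEq, true_and]
  exact ⟨add_comm _ _, by abel⟩

theorem hasDerivAt_coords_inv_mul (hu : IsUnit Nb) {γ : ℝ → Jac p (-Nb⁻¹)} {t : ℝ}
    {v : Ambient m p} (h : HasDerivAt (fun s => (γ s).coords) v t) (x : Jac p (-Nb⁻¹)) :
    HasDerivAt (fun s => (x⁻¹ * γ s).coords) (leftForm Nb x.coords v) t := by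
  simp only [coords_inv_mul hu, leftForm]
  exact (((leftConst m p + leftBilin p Nb x.coords).hasFDerivAt).comp_hasDerivAt t h).add_const _

theorem leftVelocity_eq (hu : IsUnit Nb) {γ : ℝ → Jac p (-Nb⁻¹)} {t : ℝ}
    {v : Ambient m p} (h : HasDerivAt (fun s => (γ s).coords) v t) :
    leftVelocity Jac.coords γ t = leftForm Nb (γ t).coords v :=
  (hasDerivAt_coords_inv_mul hu h _).deriv

/-- Differentiating the two constraints that define the group, gᵀN̄⁻¹g = N̄⁻¹ and Bᵀ = B, gives the
two conditions of `jac`. -/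
theorem leftForm_mem_jac (hu : IsUnit Nb) (hNb : Nbᵀ = -Nb) {γ : ℝ → Jac p (-Nb⁻¹)} {t : ℝ}
    {v : Ambient m p} (h : HasDerivAt (fun s => (γ s).coords) v t) :
    leftForm Nb (γ t).coords v ∈ jac p (-Nb⁻¹) := by
  have hdet := (Matrix.isUnit_iff_isUnit_det Nb).1 hu
  have hg : HasDerivAt (fun s => (γ s).coords.1) v.1 t := h.fst
  have hB : HasDerivAt (fun s => (γ s).coords.2.2) v.2.2 t := h.snd.snd
  rw [mem_jac_iff hNb, leftForm_eq]
  constructor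
  · have h1 := (hg.matrixTranspose.matrixMul (hasDerivAt_const t Nb⁻¹)).matrixMul hg
    have h2 : (fun s => (γ s).coords.1ᵀ * Nb⁻¹ * (γ s).coords.1) = fun _ => Nb⁻¹ :=
      funext fun s => transpose_mul_inv_mul (γ s).right
    rw [h2] at h1
    have h3 := h1.unique (hasDerivAt_const t _)
    simp only [Matrix.mul_assoc, Matrix.mul_zero, zero_add] at h3 ⊢
    rw [Matrix.nonsing_inv_mul_cancel_left _ _ hdet, Matrix.IsSymm, Matrix.transpose_mul,
      Matrix.transpose_mul, inv_transpose_eq_neg hNb, Matrix.transpose_transpose]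
    rw [Matrix.mul_neg, Matrix.neg_mul, Matrix.mul_assoc]
    exact (eq_neg_of_add_eq_zero_left h3).symm
  · refine Matrix.IsSymm.sub ?_ (cocycle_isSymm _ _ _)
    have h2 : (fun s => (γ s).coords.2.2ᵀ) = fun s => (γ s).coords.2.2 :=
      funext fun s => (γ s).left.symm
    have h1 := hB.matrixTranspose
    rw [h2] at h1
    exact h1.unique hB

/-- The factor gᵀN̄⁻¹g collapses to N̄⁻¹, and ζᵀN̄⁻¹ = −N̄⁻¹ζ in the symplectic component. The base
point disappears, as left invariance demands. -/
theorem conj_transpose_mul_mul {κ : Type*} (hu : IsUnit Nb) (hNb : Nbᵀ = -Nb)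
    (x : Jac p (-Nb⁻¹)) {ζ : Ambient m p} (hζ : ζ ∈ jac p (-Nb⁻¹)) (C : Matrix m κ ℝ) :
    Nb * (x.coords.1 * ζ.1)ᵀ * Nb⁻¹ * (x.coords.1 * C) = -(ζ.1 * C) := by
  have hx : x.coords.1ᵀ * Nb⁻¹ * x.coords.1 = Nb⁻¹ := transpose_mul_inv_mul x.right
  have hsp : ζ.1ᵀ * Nb⁻¹ = -(Nb⁻¹ * ζ.1) := by
    have h := ((mem_jac_iff hNb ζ).1 hζ).1.eq
    rw [Matrix.transpose_mul, inv_transpose_eq_neg hNb, Matrix.mul_neg] at h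
    rw [← h, neg_neg]
  calc Nb * (x.coords.1 * ζ.1)ᵀ * Nb⁻¹ * (x.coords.1 * C)
      = Nb * (ζ.1ᵀ * (x.coords.1ᵀ * Nb⁻¹ * x.coords.1)) * C := by
        simp only [Matrix.transpose_mul, Matrix.mul_assoc]
    _ = -(ζ.1 * C) := by
        rw [hx, hsp, Matrix.mul_neg,
          Matrix.mul_nonsing_inv_cancel_left _ _ ((Matrix.isUnit_iff_isUnit_det Nb).1 hu),
          Matrix.neg_mul]

/-- The structure equation of the generalized Jacobi group. -/
theorem leftBilin_sub_leftBilin (hu : IsUnit Nb) (hNb : Nbᵀ = -Nb) (x : Jac p (-Nb⁻¹))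
    {v w ξ η : Ambient m p} (hξ : leftForm Nb x.coords v = ξ) (hη : leftForm Nb x.coords w = η)
    (hξ' : ξ ∈ jac p (-Nb⁻¹)) (hη' : η ∈ jac p (-Nb⁻¹)) :
    leftBilin p Nb w v - leftBilin p Nb v w = bracket (-Nb⁻¹) ξ η := by
  have hmul := fun {ζ : Ambient m p} (hζ : ζ ∈ jac p (-Nb⁻¹)) (C : Matrix m m ℝ) =>
    conj_transpose_mul_mul hu hNb x hζ C
  have hmul' := fun {ζ : Ambient m p} (hζ : ζ ∈ jac p (-Nb⁻¹)) (C : Matrix m p ℝ) =>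
    conj_transpose_mul_mul hu hNb x hζ C
  have hxx : x.coords.1 * (Nb * x.coords.1ᵀ * Nb⁻¹) = 1 :=
    mul_eq_one_comm.1 (conj_transpose_mul hu x.right)
  have key : ∀ {v ξ : Ambient m p}, leftForm Nb x.coords v = ξ →
      v.1 = x.coords.1 * ξ.1 ∧ v.2.1 = x.coords.1 * ξ.2.1 := by
    rintro v ξ rfl
    rw [leftForm_eq]
    constructor
    · rw [← Matrix.mul_assoc, hxx, Matrix.one_mul]
    · rw [← Matrix.mul_assoc, hxx, Matrix.one_mul]
  obtain ⟨hv1, hv2⟩ := key hξ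
  obtain ⟨hw1, hw2⟩ := key hη
  have hc : ∀ A C : Matrix m p ℝ, cocycle (-Nb⁻¹) (x.coords.1 * A) (x.coords.1 * C)
      = cocycle (-Nb⁻¹) A C := fun A C => cocycle_sp _ x.right A C
  -- In the last component the two cocycle terms reinforce each other by antisymmetry, whence the
  -- factor 2 in `bracket`.
  rw [leftBilin_apply, leftBilin_apply, hv1, hv2, hw1, hw2, hmul hη', hmul hξ', hmul' hη',
    hmul' hξ', hc, hc, bracket, cocycle_swap hNb η.2.1]
  simp only [Prod.mk_sub_mk, Prod.mk.injEq]
  exact ⟨by abel, by abel, by module⟩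

/-! ### Curves with given left velocity -/

theorem symPart_isSymm (M : Matrix p p ℝ) : (symPart M).IsSymm := by
  simp [symPart, Matrix.IsSymm, add_comm]

theorem symPart_of_isSymm {M : Matrix p p ℝ} (h : M.IsSymm) : symPart M = M := by
  rw [symPart, h]; module

/-- The equation x′ = xS is linear and is solved among all matrices. The product of x with N̄xᵀN̄⁻¹
then has zero derivative and equals 1 at `t₀`, which gives invertibility and the symplectic relation
together. -/
theorem exists_curve_sp (hu : IsUnit Nb) (hNb : Nbᵀ = -Nb) {I : Set ℝ} (hI : IsOpen I)
    (hc : I.OrdConnected) {S : ℝ → Matrix m m ℝ} (hS : ContinuousOn S I)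
    (hS' : ∀ t ∈ I, (Nb⁻¹ * S t).IsSymm) {t₀ : ℝ} (ht₀ : t₀ ∈ I) (g₀ : Sp (-Nb⁻¹)) :
    ∃ g : ℝ → Sp (-Nb⁻¹), g t₀ = g₀ ∧
      ∀ t ∈ I, HasDerivAt (fun s => (g s : GL m ℝ).val) ((g t : GL m ℝ).val * S t) t := by
  classical
  have hdet := (Matrix.isUnit_iff_isUnit_det Nb).1 hu
  obtain ⟨x, hx₀, hx⟩ := exists_hasDerivAt_linear hI hc
    (L := fun t => (mulL m m m).flip (S t))
    ((mulL m m m).flip.continuous.comp_continuousOn hS) ht₀ (g₀ : GL m ℝ).val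
  replace hx : ∀ t ∈ I, HasDerivAt x (x t * S t) t := hx
  have hone : ∀ t ∈ I, x t * (Nb * (x t)ᵀ * Nb⁻¹) = 1 := by
    have hd : ∀ t ∈ I, HasDerivAt (fun s => x s * (Nb * (x s)ᵀ * Nb⁻¹)) 0 t := by
      intro t ht
      have h := (hx t ht).matrixMul (((hasDerivAt_const t Nb).matrixMul
        (hx t ht).matrixTranspose).matrixMul (hasDerivAt_const t Nb⁻¹))
      convert! h using 1
      have h1 : Nb * (S t)ᵀ = -(S t * Nb) := by
        have h2 := (hS' t ht).eq
        rw [Matrix.transpose_mul, inv_transpose_eq_neg hNb] at h2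
        calc Nb * (S t)ᵀ = -(Nb * ((S t)ᵀ * -Nb⁻¹) * Nb) := by
              rw [Matrix.mul_neg, Matrix.mul_neg, Matrix.neg_mul, neg_neg, Matrix.mul_assoc,
                Matrix.mul_assoc, Matrix.nonsing_inv_mul _ hdet, Matrix.mul_one]
          _ = _ := by rw [h2, Matrix.mul_nonsing_inv_cancel_left _ _ hdet]
      rw [Matrix.transpose_mul, ← Matrix.mul_assoc Nb, h1]
      simp only [Matrix.mul_zero, Matrix.zero_mul, zero_add, add_zero, Matrix.mul_neg,
        Matrix.neg_mul, Matrix.mul_assoc, neg_add_cancel]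
    intro t ht
    have hcst : ∀ s ∈ I, (fun s => x s * (Nb * (x s)ᵀ * Nb⁻¹)) s
        = (fun s => x s * (Nb * (x s)ᵀ * Nb⁻¹)) t₀ := fun s hs =>
      hI.is_const_of_deriv_eq_zero hc.isPreconnected
        (fun r hr => (hd r hr).differentiableAt.differentiableWithinAt)
        (fun r hr => (hd r hr).deriv) hs ht₀
    have := hcst t ht
    beta_reduce at this
    rw [this, hx₀]
    exact mul_eq_one_comm.1 (conj_transpose_mul hu g₀)
  have hone' : ∀ t ∈ I, (Nb * (x t)ᵀ * Nb⁻¹) * x t = 1 := fun t ht =>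
    mul_eq_one_comm.1 (hone t ht)
  have hmem : ∀ t (ht : t ∈ I), (⟨x t, Nb * (x t)ᵀ * Nb⁻¹, hone t ht, hone' t ht⟩ : GL m ℝ)
      ∈ Sp (-Nb⁻¹) := by
    intro t ht
    change (x t)ᵀ * (-Nb⁻¹) * x t = -Nb⁻¹
    rw [Matrix.mul_neg, Matrix.neg_mul, neg_inj]
    calc (x t)ᵀ * Nb⁻¹ * x t = Nb⁻¹ * (Nb * (x t)ᵀ * Nb⁻¹ * x t) := by
          simp only [Matrix.mul_assoc]
          rw [Matrix.nonsing_inv_mul_cancel_left _ _ hdet]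
      _ = Nb⁻¹ := by rw [hone' t ht, Matrix.mul_one]
  -- The value `g₀` outside `I` is arbitrary; it does not affect derivatives on the open set `I`.
  refine ⟨fun t => if ht : t ∈ I then ⟨_, hmem t ht⟩ else g₀, ?_, fun t ht => ?_⟩
  · beta_reduce
    rw [dif_pos ht₀]
    exact Subtype.ext (Units.ext hx₀)
  · beta_reduce
    rw [dif_pos ht]
    refine (hx t ht).congr_of_eventuallyEq (eventually_of_mem (hI.mem_nhds ht) fun s hs => ?_)
    beta_reduce
    rw [dif_pos hs]

theorem contDiffOn_of_hasDerivAt {E : Type*} [NormedAddCommGroup E] [NormedSpace ℝ E]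
    {I : Set ℝ} (hI : IsOpen I) {f f' : ℝ → E} {n : ℕ} (h : ∀ t ∈ I, HasDerivAt f (f' t) t)
    (hf' : ContDiffOn ℝ n f' I) : ContDiffOn ℝ (n + 1) f I := by
  rw [contDiffOn_succ_iff_deriv_of_isOpen hI]
  exact ⟨fun t ht => (h t ht).differentiableAt.differentiableWithinAt, by simp,
    hf'.congr fun t ht => (h t ht).deriv⟩

/-- The equation γ′ = γξ is triangular: once g is known, A′ and then B′ are explicit functions of t,
and A and B are found by integration. -/
theorem exists_curve_jac (hu : IsUnit Nb) (hNb : Nbᵀ = -Nb) {I : Set ℝ} (hI : IsOpen I)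
    (hc : I.OrdConnected) {ξ : ℝ → Ambient m p} (hξ : ContDiffOn ℝ 1 ξ I)
    (hξ' : ∀ t ∈ I, ξ t ∈ jac p (-Nb⁻¹)) {t₀ : ℝ} (ht₀ : t₀ ∈ I) (g₀ : Jac p (-Nb⁻¹)) :
    ∃ γ : ℝ → Jac p (-Nb⁻¹), γ t₀ = g₀ ∧ ContDiffOn ℝ 2 (fun t => (γ t).coords) I ∧
      ∀ t ∈ I, leftVelocity Jac.coords γ t = ξ t := by
  obtain ⟨g, hg₀, hg⟩ := exists_curve_sp hu hNb hI hc (S := fun t => (ξ t).1)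
    hξ.continuousOn.fst (fun t ht => ((mem_jac_iff hNb _).1 (hξ' t ht)).1) ht₀ g₀.right
  have hg1 : ContDiffOn ℝ 1 (fun t => (g t : GL m ℝ).val) I :=
    contDiffOn_of_hasDerivAt (n := 0) hI hg (contDiffOn_zero.2 (ContDiffOn.continuousOn (n := 0)
      ((contDiffOn_zero.2 fun t ht => (hg t ht).continuousAt.continuousWithinAt).matrixMul
        (hξ.fst.of_le zero_le_one))))
  have hg' : ContDiffOn ℝ 1 (fun t => (g t : GL m ℝ).val * (ξ t).1) I := hg1.matrixMul hξ.fst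
  have hA' : ContDiffOn ℝ 1 (fun t => (g t : GL m ℝ).val * (ξ t).2.1) I :=
    hg1.matrixMul hξ.snd.fst
  set A : ℝ → Matrix m p ℝ := fun t => g₀.left.A + ∫ s in t₀..t, (g s : GL m ℝ).val * (ξ s).2.1
  have hA : ∀ t ∈ I, HasDerivAt A ((g t : GL m ℝ).val * (ξ t).2.1) t := fun t ht =>
    (hasDerivAt_primitive hI hc hA'.continuousOn ht₀ ht).const_add _
  have hA2 := contDiffOn_of_hasDerivAt (n := 1) hI hA hA'
  have hB' : ContDiffOn ℝ 1 (fun t => (ξ t).2.2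
      + cocycle (-Nb⁻¹) (A t) ((g t : GL m ℝ).val * (ξ t).2.1)) I :=
    hξ.snd.snd.add (ContDiffOn.bilinear (cocycleL p (-Nb⁻¹))
      (hA2.of_le (m := 1) (by norm_num)) hA')
  -- The integrand is known to be symmetric only on `I`, while γ must lie in the group for every
  -- real t. Hence the symmetric part of this integral is used; on `I` that does not change the
  -- derivative.
  set C : ℝ → Matrix p p ℝ := fun t => ∫ s in t₀..t, ((ξ s).2.2
      + cocycle (-Nb⁻¹) (A s) ((g s : GL m ℝ).val * (ξ s).2.1))
  have hC : ∀ t ∈ I, HasDerivAt (fun t => g₀.left.B + symPart (C t)) ((ξ t).2.2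
      + cocycle (-Nb⁻¹) (A t) ((g t : GL m ℝ).val * (ξ t).2.1)) t := by
    intro t ht
    have h := hasDerivAt_primitive hI hc hB'.continuousOn ht₀ ht
    have h1 := (((h.add h.matrixTranspose).const_smul (1 / 2 : ℝ))).const_add g₀.left.B
    rw [← symPart_of_isSymm ((((mem_jac_iff hNb _).1 (hξ' t ht)).2).add
      (cocycle_isSymm (-Nb⁻¹) (A t) ((g t : GL m ℝ).val * (ξ t).2.1)))]
    exact h1
  let γ : ℝ → Jac p (-Nb⁻¹) := fun t =>
    ⟨⟨A t, g₀.left.B + symPart (C t), g₀.left.symm.add (symPart_isSymm _)⟩, g t⟩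
  have hγ : ∀ t ∈ I, HasDerivAt (fun s => (γ s).coords) ((g t : GL m ℝ).val * (ξ t).1,
      (g t : GL m ℝ).val * (ξ t).2.1,
      (ξ t).2.2 + cocycle (-Nb⁻¹) (A t) ((g t : GL m ℝ).val * (ξ t).2.1)) t :=
    fun t ht => (hg t ht).prodMk ((hA t ht).prodMk (hC t ht))
  refine ⟨γ, ?_, contDiffOn_of_hasDerivAt (n := 1) hI hγ (hg'.prodMk (hA'.prodMk hB')),
    fun t ht => ?_⟩
  · refine SemidirectProduct.ext (Heis.ext ?_ ?_) hg₀
    · simp [γ, A]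
    · simp [γ, C, symPart]
  · rw [leftVelocity_eq hu (hγ t ht), leftForm_eq]
    have h1 : Nb * (γ t).coords.1ᵀ * Nb⁻¹ * (g t : GL m ℝ).val = 1 := conj_transpose_mul hu (g t)
    simp only [← Matrix.mul_assoc] at h1 ⊢
    rw [h1, Matrix.one_mul, Matrix.one_mul]
    refine Prod.ext rfl (Prod.ext rfl ?_)
    exact add_sub_cancel_right _ _

end GroupCalculus


/-! ### Geodesics and the Bloch–Iserles system -/

section Main

variable {m p ι : Type*} [Fintype m] [DecidableEq m] [Fintype p] [DecidableEq p]
  [Fintype ι] [DecidableEq ι] {Nb : Matrix m m ℝ} {O : Matrix ι (m ⊕ p) ℝ}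

theorem toSym_add (ξ ζ : Ambient m p) : toSym O Nb (ξ + ζ) = toSym O Nb ξ + toSym O Nb ζ := by
  simp only [toSym_eq, blockSym]
  rw [← Matrix.add_mul, ← Matrix.mul_add, Matrix.fromBlocks_add]
  simp only [Prod.fst_add, Prod.snd_add, Matrix.mul_add, Matrix.transpose_add, smul_add]

theorem toSym_smul (c : ℝ) (ξ : Ambient m p) : toSym O Nb (c • ξ) = c • toSym O Nb ξ := by
  simp only [toSym_eq, blockSym]
  rw [← Matrix.smul_mul, ← Matrix.mul_smul, Matrix.fromBlocks_smul]
  simp only [Prod.smul_fst, Prod.smul_snd, Matrix.mul_smul, Matrix.transpose_smul, smul_comm c]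

/-- The map `toSym` as a continuous linear map. -/
noncomputable def toSymL (O : Matrix ι (m ⊕ p) ℝ) (Nb : Matrix m m ℝ) : Ambient m p →L[ℝ] Matrix ι ι ℝ :=
  ({ toFun := toSym O Nb
     map_add' := toSym_add
     map_smul' := toSym_smul } : Ambient m p →ₗ[ℝ] Matrix ι ι ℝ).toContinuousLinearMap

@[simp] theorem toSymL_apply (ξ : Ambient m p) : toSymL O Nb ξ = toSym O Nb ξ := rfl

theorem ofSym_add (X Y : Matrix ι ι ℝ) :
    ofSym O Nb (X + Y) = ofSym O Nb X + ofSym O Nb Y := by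
  have h : Oᵀ * (X + Y) * O = Oᵀ * X * O + Oᵀ * Y * O := by rw [Matrix.mul_add, Matrix.add_mul]
  rw [ofSym, h]
  exact Prod.ext (Matrix.mul_add _ _ _) (Prod.ext (Matrix.mul_add _ _ _) (smul_add _ _ _))

theorem ofSym_smul (c : ℝ) (X : Matrix ι ι ℝ) : ofSym O Nb (c • X) = c • ofSym O Nb X := by
  have h : Oᵀ * (c • X) * O = c • (Oᵀ * X * O) := by rw [Matrix.mul_smul, Matrix.smul_mul]
  rw [ofSym, h]
  exact Prod.ext (Matrix.mul_smul Nb c (Oᵀ * X * O).toBlocks₁₁) (Prod.ext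
    (Matrix.mul_smul Nb c (Oᵀ * X * O).toBlocks₁₂)
    (smul_comm (1 / 2 : ℝ) c (Oᵀ * X * O).toBlocks₂₂))

/-- The map `ofSym` as a continuous linear map. -/
noncomputable def ofSymL (O : Matrix ι (m ⊕ p) ℝ) (Nb : Matrix m m ℝ) : Matrix ι ι ℝ →L[ℝ] Ambient m p :=
  ({ toFun := ofSym O Nb
     map_add' := ofSym_add
     map_smul' := ofSym_smul } : Matrix ι ι ℝ →ₗ[ℝ] Ambient m p).toContinuousLinearMap

/-- The trace form `(ξ, ζ) ↦ Tr(Θ ξ Θ ζ)`, with `Θ = toSym`. -/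
noncomputable def traceForm (O : Matrix ι (m ⊕ p) ℝ) (Nb : Matrix m m ℝ) :
    Ambient m p →L[ℝ] Ambient m p →L[ℝ] ℝ :=
  (LinearMap.mk₂ ℝ (fun ξ ζ : Ambient m p => (toSym O Nb ξ * toSym O Nb ζ).trace)
    (fun ξ ξ' ζ => by rw [toSym_add, Matrix.add_mul, Matrix.trace_add])
    (fun c ξ ζ => by rw [toSym_smul, Matrix.smul_mul, Matrix.trace_smul])
    (fun ξ ζ ζ' => by rw [toSym_add, Matrix.mul_add, Matrix.trace_add])
    (fun c ξ ζ => by rw [toSym_smul, Matrix.mul_smul, Matrix.trace_smul])).toContinuousBilinearMap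

@[simp] theorem traceForm_apply (ξ ζ : Ambient m p) :
    traceForm O Nb ξ ζ = (toSym O Nb ξ * toSym O Nb ζ).trace := rfl

theorem hasDerivAt_coords {I : Set ℝ} (hI : IsOpen I) {γ : ℝ → Jac p (-Nb⁻¹)}
    (hγ : ContDiffOn ℝ 2 (fun t => (γ t).coords) I) {t : ℝ} (ht : t ∈ I) :
    HasDerivAt (fun s => (γ s).coords) (deriv (fun s => (γ s).coords) t) t :=
  ((hγ.of_le (by norm_num)).differentiableAt_of_isOpen hI ht).hasDerivAt

theorem leftVelocity_mem_jac (hu : IsUnit Nb) (hNb : Nbᵀ = -Nb) {I : Set ℝ} (hI : IsOpen I)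
    {γ : ℝ → Jac p (-Nb⁻¹)} (hγ : ContDiffOn ℝ 2 (fun t => (γ t).coords) I) {t : ℝ}
    (ht : t ∈ I) : leftVelocity Jac.coords γ t ∈ jac p (-Nb⁻¹) := by
  rw [leftVelocity_eq hu (hasDerivAt_coords hI hγ ht)]
  exact leftForm_mem_jac hu hNb (hasDerivAt_coords hI hγ ht)

theorem contDiffOn_leftVelocity (hu : IsUnit Nb) {I : Set ℝ} (hI : IsOpen I)
    {γ : ℝ → Jac p (-Nb⁻¹)} (hγ : ContDiffOn ℝ 2 (fun t => (γ t).coords) I) :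
    ContDiffOn ℝ 1 (leftVelocity Jac.coords γ) I := by
  have hd : ContDiffOn ℝ 1 (deriv fun s => (γ s).coords) I :=
    hγ.deriv_of_isOpen hI (by norm_num)
  have h : ContDiffOn ℝ 1 (fun t => leftConst m p (deriv (fun s => (γ s).coords) t)
      + leftBilin p Nb (γ t).coords (deriv (fun s => (γ s).coords) t)) I :=
    ((leftConst m p).contDiff.comp_contDiffOn hd).add
      (ContDiffOn.bilinear (leftBilin p Nb) (hγ.of_le (by norm_num)) hd)
  exact h.congr fun t ht => leftVelocity_eq hu (hasDerivAt_coords hI hγ ht)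

/-- The first variation of the action of the left-invariant metric. -/
theorem hasDerivAt_action (hu : IsUnit Nb) (hNb : Nbᵀ = -Nb) (hO : Oᵀ * O = 1)
    {N : Matrix ι ι ℝ} (hN : N = O * Matrix.fromBlocks Nb 0 0 (0 : Matrix p p ℝ) * Oᵀ)
    {I : Set ℝ} (hI : IsOpen I) (hc : I.OrdConnected) {γ : ℝ → Jac p (-Nb⁻¹)}
    (hγ : ContDiffOn ℝ 2 (fun t => (γ t).coords) I) {a b : ℝ} (ha : a ∈ I) (hb : b ∈ I)
    (hab : a < b) {δ : ℝ} (hδ : 0 < δ) {F : ℝ → ℝ → Jac p (-Nb⁻¹)}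
    (hF : ContDiffOn ℝ 2 (fun q : ℝ × ℝ => (F q.1 q.2).coords) (Ioo (-δ) δ ×ˢ I))
    (hF0 : ∀ t ∈ I, F 0 t = γ t) (hFab : ∀ ε ∈ Ioo (-δ) δ, F ε a = γ a ∧ F ε b = γ b)
    {X : ℝ → Matrix ι ι ℝ} (hX : X = fun t => toSym O Nb (leftVelocity Jac.coords γ t)) :
    HasDerivAt (fun ε => ∫ t in a..b, lagrangian Nb (leftVelocity Jac.coords (F ε) t))
      (∫ t in a..b, ((X t ^ 2 * N - N * X t ^ 2 - deriv X t)
        * toSym O Nb (leftVelocity Jac.coords (fun ε => F ε t) 0)).trace) 0 := by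
  have hsub : Icc a b ⊆ I := hc.out ha hb
  have hU : IsOpen (Ioo (-δ) δ ×ˢ I) := isOpen_Ioo.prod hI
  have h0 : (0 : ℝ) ∈ Ioo (-δ) δ := ⟨by linarith, hδ⟩
  set u : ℝ × ℝ → Ambient m p := fun q => (F q.1 q.2).coords
  have hdu : ∀ q ∈ Ioo (-δ) δ ×ˢ I, DifferentiableAt ℝ u q := fun q hq =>
    (hF.of_le (by norm_num)).differentiableAt_of_isOpen hU hq
  have hT : ∀ q ∈ Ioo (-δ) δ ×ˢ I,
      HasDerivAt (fun s => (F q.1 s).coords) (fderiv ℝ u q (0, 1)) q.2 := fun q hq =>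
    hasDerivAt_slice_right (hdu q hq)
  have hE : ∀ q ∈ Ioo (-δ) δ ×ˢ I,
      HasDerivAt (fun ε => (F ε q.2).coords) (fderiv ℝ u q (1, 0)) q.1 := fun q hq =>
    hasDerivAt_slice_left (hdu q hq)
  have key := hasDerivAt_energy (leftConst m p) (leftBilin p Nb) (traceForm O Nb)
    (fun x y => Matrix.trace_mul_comm _ _) hI hδ hF hab.le hsub
    (fun ε hε => congrArg Jac.coords ((hFab ε hε).1.trans (hFab 0 h0).1.symm))
    (fun ε hε => congrArg Jac.coords ((hFab ε hε).2.trans (hFab 0 h0).2.symm)) rfl rfl rfl rfl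
  -- The Lagrangian is half the trace form only on `jac`, so membership of the left velocities is
  -- needed here.
  have hkey := key.congr_of_eventuallyEq
    (f₁ := fun ε => ∫ t in a..b, lagrangian Nb (leftVelocity Jac.coords (F ε) t)) <| by
      filter_upwards [Ioo_mem_nhds h0.1 h0.2] with ε hε
      refine intervalIntegral.integral_congr fun t ht => ?_
      rw [uIcc_of_le hab.le] at ht
      have h := hT (ε, t) ⟨hε, hsub ht⟩
      have hmem := leftForm_mem_jac hu hNb h
      rw [leftVelocity_eq hu h, lagrangian_eq hNb hO hmem]
      rfl
  convert! hkey using 1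
  refine intervalIntegral.integral_congr fun t ht => ?_
  rw [uIcc_of_le hab.le] at ht
  have htI := hsub ht
  have hη : leftForm Nb (F 0 t).coords (fderiv ℝ u (0, t) (1, 0))
      = leftVelocity Jac.coords (fun ε => F ε t) 0 :=
    (leftVelocity_eq hu (hE (0, t) ⟨h0, htI⟩)).symm
  have hη' := leftForm_mem_jac hu hNb (hE (0, t) ⟨h0, htI⟩)
  have hξ : ∀ s ∈ I, leftForm Nb (F 0 s).coords (fderiv ℝ u (0, s) (0, 1))
      = leftVelocity Jac.coords γ s := by
    intro s hs
    have h1 : HasDerivAt (fun r => (γ r).coords) (fderiv ℝ u (0, s) (0, 1)) s :=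
      (hT (0, s) ⟨h0, hs⟩).congr_of_eventuallyEq (eventually_of_mem (hI.mem_nhds hs)
        fun r hr => by simp only [hF0 r hr])
    rw [leftVelocity_eq hu h1, hF0 s hs]
  have hξ' := leftForm_mem_jac hu hNb (hT (0, t) ⟨h0, htI⟩)
  have hbr := leftBilin_sub_leftBilin hu hNb (F 0 t) rfl rfl hξ' hη'
  have hdX : deriv X t = toSym O Nb (deriv (fun s => leftForm Nb (F 0 s).coords
      (fderiv ℝ u (0, s) (0, 1))) t) := by
    have h1 : (fun s => leftForm Nb (F 0 s).coords (fderiv ℝ u (0, s) (0, 1)))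
        =ᶠ[𝓝 t] leftVelocity Jac.coords γ := eventually_of_mem (hI.mem_nhds htI) hξ
    refine Eq.trans ?_ (congrArg (toSym O Nb) h1.deriv_eq.symm)
    rw [hX]
    exact ((toSymL O Nb).hasFDerivAt.comp_hasDerivAt t
      ((contDiffOn_leftVelocity hu hI hγ).differentiableAt_of_isOpen hI htI).hasDerivAt).deriv
  have hXt : X t = toSym O Nb (leftForm Nb (F 0 t).coords (fderiv ℝ u (0, t) (0, 1))) := by
    rw [hX, hξ t htI]
  -- The structure equation and `toSym_bracket` turn the antisymmetrised bilinear term into XNY −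
  -- YNX, and `trace_mul_bracket` moves Y to the right.
  rw [← hη, Matrix.sub_mul, Matrix.trace_sub, hdX, ← trace_mul_bracket, hXt,
    ← toSym_bracket hu hNb hO hN hξ' hη', ← hbr]
  rfl

theorem contDiffOn_coords_mul {Ω : Matrix m m ℝ} {E : Type*} [NormedAddCommGroup E]
    [NormedSpace ℝ E] {n : WithTop ℕ∞} {s : Set E} {f g : E → Jac p Ω}
    (hf : ContDiffOn ℝ n (fun x => (f x).coords) s)
    (hg : ContDiffOn ℝ n (fun x => (g x).coords) s) :
    ContDiffOn ℝ n (fun x => (f x * g x).coords) s := by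
  simp only [coords_mul]
  have h := hf.fst.matrixMul hg.snd.fst
  exact (hf.fst.matrixMul hg.fst).prodMk ((hf.snd.fst.add h).prodMk
    ((hf.snd.snd.add hg.snd.snd).add (ContDiffOn.bilinear (cocycleL p Ω) hf.snd.fst h)))

/-- A variation of a curve with fixed end points, in a given direction. -/
theorem exists_variation (hu : IsUnit Nb) (hNb : Nbᵀ = -Nb) {I : Set ℝ}
    {γ : ℝ → Jac p (-Nb⁻¹)} (hγ : ContDiffOn ℝ 2 (fun t => (γ t).coords) I) (a b : ℝ)
    {ζ : Ambient m p} (hζ : ζ ∈ jac p (-Nb⁻¹)) :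
    ∃ F : ℝ → ℝ → Jac p (-Nb⁻¹),
      ContDiffOn ℝ 2 (fun q : ℝ × ℝ => (F q.1 q.2).coords) (Ioo (-1) 1 ×ˢ I) ∧
      (∀ t, F 0 t = γ t) ∧ (∀ ε, F ε a = γ a ∧ F ε b = γ b) ∧
      ∀ t, leftVelocity Jac.coords (fun ε => F ε t) 0 = ((t - a) * (b - t)) • ζ := by
  -- Constant left velocity ζ provides a globally defined curve through the identity; only its
  -- smoothness, its value and its velocity at 0 are used.
  obtain ⟨h, h0, hC, hv⟩ := exists_curve_jac hu hNb isOpen_univ ordConnected_univ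
    (ξ := fun _ => ζ) contDiffOn_const (fun _ _ => hζ) (mem_univ 0) (1 : Jac p (-Nb⁻¹))
  have hd : HasDerivAt (fun s => (h s).coords) ζ 0 := by
    have h1 := hv 0 (mem_univ 0)
    simp only [leftVelocity, h0, inv_one, one_mul] at h1
    rw [← h1]
    exact hasDerivAt_coords isOpen_univ hC (mem_univ 0)
  -- The factor (t − a)(b − t) fixes the end points and is the weight of
  -- `eq_zero_of_forall_integral_eq_zero`. Multiplication on the right makes the left-translated
  -- variation field a multiple of ζ.
  refine ⟨fun ε t => γ t * h (ε * ((t - a) * (b - t))), ?_, ?_, ?_, ?_⟩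
  · refine contDiffOn_coords_mul (hγ.comp contDiffOn_snd fun q hq => hq.2)
      (ContDiffOn.comp (g := fun s => (h s).coords) hC (ContDiff.contDiffOn ?_)
        fun _ _ => mem_univ _)
    fun_prop
  · intro t
    simp [h0]
  · intro ε
    simp [h0]
  · intro t
    have h2 : HasDerivAt (fun ε : ℝ => ε * ((t - a) * (b - t))) ((t - a) * (b - t)) 0 := by
      simpa using (hasDerivAt_id (0 : ℝ)).mul_const ((t - a) * (b - t))
    have h3 : HasDerivAt (fun ε => (h (ε * ((t - a) * (b - t)))).coords)
        (((t - a) * (b - t)) • ζ) 0 :=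
      HasDerivAt.scomp (g₁ := fun s => (h s).coords) 0 (by rw [zero_mul]; exact hd) h2
    simp only [leftVelocity, zero_mul, h0, mul_one, inv_mul_cancel_left]
    exact h3.deriv

/-- Needed so that the residual X²N − NX² − X′ is symmetric and hence itself an admissible test
direction. -/
theorem commutator_isSymm {N X : Matrix ι ι ℝ} (hN : Nᵀ = -N) (hX : X.IsSymm) :
    (X ^ 2 * N - N * X ^ 2).IsSymm := by
  rw [Matrix.IsSymm, Matrix.transpose_sub, Matrix.transpose_mul, Matrix.transpose_mul, hN,
    Matrix.transpose_pow, hX]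
  simp only [Matrix.neg_mul, Matrix.mul_neg]
  abel

/-- A curve is a geodesic if and only if its left velocity solves the Bloch–Iserles system. -/
theorem isGeodesicOn_iff (hu : IsUnit Nb) (hNb : Nbᵀ = -Nb) (hO : Oᵀ * O = 1) (hO' : O * Oᵀ = 1)
    {N : Matrix ι ι ℝ} (hNt : Nᵀ = -N)
    (hN : N = O * Matrix.fromBlocks Nb 0 0 (0 : Matrix p p ℝ) * Oᵀ)
    {I : Set ℝ} (hI : IsOpen I) (hc : I.OrdConnected) {γ : ℝ → Jac p (-Nb⁻¹)}
    (hγ : ContDiffOn ℝ 2 (fun t => (γ t).coords) I) :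
    IsGeodesicOn Jac.coords (lagrangian Nb) γ I ↔
      IsBlochIserlesSolutionOn N (fun t => toSym O Nb (leftVelocity Jac.coords γ t)) I := by
  set X : ℝ → Matrix ι ι ℝ := fun t => toSym O Nb (leftVelocity Jac.coords γ t) with hX
  have hXs : ∀ t ∈ I, (X t).IsSymm := fun t ht =>
    toSym_isSymm hNb (leftVelocity_mem_jac hu hNb hI hγ ht)
  constructor
  · rintro ⟨-, hgeo⟩ t ht
    refine ⟨hXs t ht, ?_⟩
    have hX1 : ContDiffOn ℝ 1 X I :=
      (toSymL O Nb).contDiff.comp_contDiffOn (contDiffOn_leftVelocity hu hI hγ)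
    have hXd : HasDerivAt X (deriv X t) t := (hX1.differentiableAt_of_isOpen hI ht).hasDerivAt
    have hcont : ContinuousOn (fun t => X t ^ 2 * N - N * X t ^ 2 - deriv X t) I := by
      have h1 : ContinuousOn (fun t => X t ^ 2) I := by
        simp only [pow_two]
        exact (hX1.matrixMul hX1).continuousOn
      have h2 := hX1.continuousOn_deriv_of_isOpen hI le_rfl
      exact (((mulL ι ι ι).flip N).continuous.comp_continuousOn h1).sub
        ((mulL ι ι ι N).continuous.comp_continuousOn h1) |>.sub h2
    have hdsymm : (deriv X t).IsSymm := by
      have h1 : (fun s => (X s)ᵀ) =ᶠ[𝓝 t] X := eventually_of_mem (hI.mem_nhds ht) hXs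
      exact (hXd.matrixTranspose.congr_of_eventuallyEq h1.symm).unique hXd
    have horth : ∀ ζ ∈ jac p (-Nb⁻¹),
        ((X t ^ 2 * N - N * X t ^ 2 - deriv X t) * toSym O Nb ζ).trace = 0 := by
      intro ζ hζ
      refine eq_zero_of_forall_integral_eq_zero hI
        (f := fun t => ((X t ^ 2 * N - N * X t ^ 2 - deriv X t) * toSym O Nb ζ).trace) ?_ ?_ t ht
      · exact (Matrix.traceLinearMap ι ℝ ℝ).toContinuousLinearMap.continuous.comp_continuousOn
          (((mulL ι ι ι).flip (toSym O Nb ζ)).continuous.comp_continuousOn hcont)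
      · intro a b hab hsub
        have ha := hsub (left_mem_Icc.2 hab.le)
        have hb := hsub (right_mem_Icc.2 hab.le)
        obtain ⟨F, hF, hF0, hFab, hFv⟩ := exists_variation hu hNb hγ a b hζ
        have h1 := hgeo a ha b hb hab 1 F one_pos hF (fun t _ => hF0 t) (fun ε _ => hFab ε)
        have h2 := hasDerivAt_action hu hNb hO hN hI hc hγ ha hb hab one_pos hF
          (fun t _ => hF0 t) (fun ε _ => hFab ε) hX
        have h3 := h2.unique h1
        simpa only [hFv, toSym_smul, Matrix.mul_smul, Matrix.trace_smul, smul_eq_mul] using h3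
    have hY : (X t ^ 2 * N - N * X t ^ 2 - deriv X t).IsSymm :=
      (commutator_isSymm hNt (hXs t ht)).sub hdsymm
    -- The residual is tested against its own preimage under Θ, and the trace form is positive
    -- definite on symmetric matrices.
    have hY0 : X t ^ 2 * N - N * X t ^ 2 - deriv X t = 0 := by
      by_contra hne
      have h1 := horth _ (ofSym_mem_jac (O := O) hu hNb hY)
      rw [toSym_ofSym hu hO' hY] at h1
      exact (trace_mul_self_pos hY hne).ne' h1
    rw [sub_eq_zero.1 hY0]
    exact hXd
  · intro hBI
    refine ⟨hγ, fun a ha b hb hab δ F hδ hF hF0 hFab => ?_⟩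
    have h := hasDerivAt_action hu hNb hO hN hI hc hγ ha hb hab hδ hF hF0 hFab hX
    convert! h using 1
    symm
    refine intervalIntegral.integral_zero_ae (.of_forall fun t ht => ?_)
    have htI : t ∈ I := hc.out ha hb (Ioc_subset_Icc_self (uIoc_of_le hab.le ▸ ht))
    have hd : deriv X t = X t ^ 2 * N - N * X t ^ 2 := (hBI t htI).2.deriv
    rw [hd, sub_self, Matrix.zero_mul, Matrix.trace_zero]

/-- Each solution of the Bloch–Iserles system comes from a geodesic. -/
theorem exists_isGeodesicOn (hu : IsUnit Nb) (hNb : Nbᵀ = -Nb) (hO : Oᵀ * O = 1)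
    (hO' : O * Oᵀ = 1) {N : Matrix ι ι ℝ} (hNt : Nᵀ = -N)
    (hN : N = O * Matrix.fromBlocks Nb 0 0 (0 : Matrix p p ℝ) * Oᵀ)
    {I : Set ℝ} (hI : IsOpen I) (hc : I.OrdConnected) {X : ℝ → Matrix ι ι ℝ}
    (hX : IsBlochIserlesSolutionOn N X I) {t₀ : ℝ} (ht₀ : t₀ ∈ I) (g₀ : Jac p (-Nb⁻¹)) :
    ∃ γ : ℝ → Jac p (-Nb⁻¹), γ t₀ = g₀ ∧ IsGeodesicOn Jac.coords (lagrangian Nb) γ I ∧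
      ∀ t ∈ I, toSym O Nb (leftVelocity Jac.coords γ t) = X t := by
  have hX0 : ContDiffOn ℝ 0 X I :=
    contDiffOn_zero.2 fun t ht => (hX t ht).2.continuousAt.continuousWithinAt
  -- The right side of the system is polynomial in X, so a differentiable solution is automatically
  -- C¹; this makes the reconstructed curve C².
  have hX1 : ContDiffOn ℝ 1 X I := by
    refine contDiffOn_of_hasDerivAt (n := 0) hI (fun t ht => (hX t ht).2) ?_
    simp only [pow_two]
    exact ((hX0.matrixMul hX0).matrixMul contDiffOn_const).sub
      (contDiffOn_const.matrixMul (hX0.matrixMul hX0))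
  have hξ1 : ContDiffOn ℝ 1 (fun t => ofSym O Nb (X t)) I :=
    (ofSymL O Nb).contDiff.comp_contDiffOn hX1
  obtain ⟨γ, hγ0, hγ, hv⟩ := exists_curve_jac hu hNb hI hc hξ1
    (fun t ht => ofSym_mem_jac hu hNb (hX t ht).1) ht₀ g₀
  have hvX : ∀ t ∈ I, toSym O Nb (leftVelocity Jac.coords γ t) = X t := fun t ht => by
    rw [hv t ht, toSym_ofSym hu hO' (hX t ht).1]
  refine ⟨γ, hγ0, (isGeodesicOn_iff hu hNb hO hO' hNt hN hI hc hγ).2 fun t ht => ?_, hvX⟩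
  beta_reduce
  rw [hvX t ht]
  exact ⟨(hX t ht).1, (hX t ht).2.congr_of_eventuallyEq (eventually_of_mem (hI.mem_nhds ht) hvX)⟩

end Main

end BlochIserles

theorem mainTheorem2 (n d : ℕ) (N : Matrix (Fin n) (Fin n) ℝ) (hN : Nᵀ = -N)
    (hd : N.rank + d = n) :
    (∃ (k : ℕ) (O : Matrix (Fin n) (Fin (2 * k) ⊕ Fin d) ℝ)
        (Nb : Matrix (Fin (2 * k)) (Fin (2 * k)) ℝ),
      Oᵀ * O = 1 ∧ O * Oᵀ = 1 ∧ IsUnit Nb ∧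
        N = O * Matrix.fromBlocks Nb 0 0 (0 : Matrix (Fin d) (Fin d) ℝ) * Oᵀ) ∧
    ∀ (k : ℕ) (O : Matrix (Fin n) (Fin (2 * k) ⊕ Fin d) ℝ)
        (Nb : Matrix (Fin (2 * k)) (Fin (2 * k)) ℝ),
      Oᵀ * O = 1 → O * Oᵀ = 1 → IsUnit Nb →
      N = O * Matrix.fromBlocks Nb 0 0 (0 : Matrix (Fin d) (Fin d) ℝ) * Oᵀ →
      -- `ℓ` is positive definite on the tangent space at the identity
      (∀ ξ ∈ BlochIserles.jac (Fin d) (-Nb⁻¹), ξ ≠ 0 → 0 < BlochIserles.lagrangian Nb ξ) ∧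
      -- this tangent space is identified with the space of symmetric `n × n` matrices
      Set.BijOn (BlochIserles.toSym O Nb)
        (BlochIserles.jac (Fin d) (-Nb⁻¹)) {X | X.IsSymm} ∧
      -- a curve is a geodesic iff its left velocity solves the Bloch–Iserles system
      (∀ (I : Set ℝ) (γ : ℝ → BlochIserles.Jac (Fin d) (-Nb⁻¹)), IsOpen I → I.OrdConnected →
        ContDiffOn ℝ 2 (fun t => (γ t).coords) I →
        (BlochIserles.IsGeodesicOn BlochIserles.Jac.coords (BlochIserles.lagrangian Nb) γ I ↔
          BlochIserles.IsBlochIserlesSolutionOn N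
            (fun t => BlochIserles.toSym O Nb
              (BlochIserles.leftVelocity BlochIserles.Jac.coords γ t)) I)) ∧
      -- each solution of the Bloch–Iserles system comes from a geodesic
      (∀ (I : Set ℝ) (X : ℝ → Matrix (Fin n) (Fin n) ℝ), IsOpen I → I.OrdConnected →
        BlochIserles.IsBlochIserlesSolutionOn N X I →
        ∀ t₀ ∈ I, ∀ g₀ : BlochIserles.Jac (Fin d) (-Nb⁻¹),
          ∃ γ : ℝ → BlochIserles.Jac (Fin d) (-Nb⁻¹),
            γ t₀ = g₀ ∧
            BlochIserles.IsGeodesicOn BlochIserles.Jac.coords (BlochIserles.lagrangian Nb) γ I ∧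
            ∀ t ∈ I, BlochIserles.toSym O Nb
              (BlochIserles.leftVelocity BlochIserles.Jac.coords γ t) = X t) := by
  refine ⟨BlochIserles.exists_normalForm hN hd, fun k O Nb hO hO' hu hNeq => ?_⟩
  have hNb := BlochIserles.transpose_eq_neg_of_normalForm hN hO hNeq
  exact ⟨fun ξ hξ h0 => BlochIserles.lagrangian_pos hu hNb hO hξ h0,
    BlochIserles.bijOn_toSym hu hNb hO hO',
    fun I γ hI hc hγ => BlochIserles.isGeodesicOn_iff hu hNb hO hO' hN hNeq hI hc hγ,
    fun I X hI hc hX t₀ ht₀ g₀ =>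
      BlochIserles.exists_isGeodesicOn hu hNb hO hO' hN hNeq hI hc hX ht₀ g₀⟩
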